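/- Let $C([0,\infty])$ be the Banach space of continuous functions $f:[0,\infty[\to\mathbb C$ having a finite limit at $\infty$, with the sup-norm $\|\cdot\|_\infty$. For $\gamma>0$, $b\ge 0$, $t>0$, $x\ge 0$ and $f\in C([0,\infty])$ set $$P_t^{\gamma,b}f(x)=\int_0^\infty (\gamma t)^{-\frac b\gamma}e^{-\frac{x+y}{\gamma t}}y^{\frac b\gamma-1}\sum_{m=0}^\infty\frac{1}{m!\,\Gamma(m+\frac b\gamma)}\frac{x^my^m}{\gamma^{2m}t^{2m}}\,f(y)\,dy\qquad\text{if } b>0,$$ $$P_t^{\gamma,0}f(x)=e^{-\frac{x}{\gamma t}}f(0)+\int_0^\infty(\gamma t)^{-1}e^{-\frac{x+y}{\gamma t}}\sum_{m=0}^\infty\frac{1}{(m+1)!\,m!}\frac{x^{m+1}y^m}{\gamma^{2m+1}t^{2m+1}}\,f(y)\,dy .$$ Let $A^{\gamma,b}u(x)=\gamma xu''(x)+bu'(x)$, an operator in $C([0,\infty])$ with domain $$D(A^{\gamma,0})=\{u\in C([0,\infty])\cap C^2(]0,\infty[)\mid \lim_{x\to0^+}A^{\gamma,0}u(x)=0,\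 \lim_{x\to+\infty}A^{\gamma,0}u(x)=0\},$$ $$D(A^{\gamma,b})=\{u\in C^1([0,\infty[)\cap C^2(]0,\infty[)\cap C([0,\infty])\mid \lim_{x\to0^+}xu''(x)=0,\ \lim_{x\to+\infty}A^{\gamma,b}u(x)=0\}\quad\text{if } b>0$$ (for $u$ in the domain, $A^{\gamma,b}u$ extends continuously to $[0,\infty]$), and write $R(\lambda,A^{\gamma,b})=(\lambda-A^{\gamma,b})^{-1}$ for $\lambda$ in the resolvent set of $A^{\gamma,b}$. **Proposition.** Let $B,\gamma_0>0$. Then the following properties hold. (1) For every $b\in[0,B]$, $\gamma\ge\gamma_0$, $f\in C([0,\infty])$ and $t>0$, $P_t^{\gamma,b}f\in C^1([0,\infty[)$ and $$|\sqrt x\,(P_t^{\gamma,b}f)'(x)|\le\frac{2\sqrt2}{\sqrt{\gamma_0t}}\|f\|_\infty,\qquad x\ge0.$$ (2) There exists $\theta_1=\theta_1(B,\gamma_0)\in\,]0,\frac\pi2]$ such that, for every $\theta\in\,]0,\theta_1[$, there exists $d_2=d_2(B,\gamma_0,\theta)>0$ such that, for every $b\in[0,B]$, every $\gamma\ge\gamma_0$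 and every $\lambda\in\mathbb C\setminus\{0\}$ with $|\arg\lambda|\le\frac\pi2+\theta$ (where $\arg\lambda\in\,]-\pi,\pi]$), $\lambda$ belongs to the resolvent set of $A^{\gamma,b}$ and, for every $f\in C([0,\infty])$, $$R(\lambda,A^{\gamma,b})f\in C^1(]0,\infty[),\qquad \lim_{x\to0^+}\sqrt x\,(R(\lambda,A^{\gamma,b})f)'(x)=0,$$ $$|\sqrt x\,(R(\lambda,A^{\gamma,b})f)'(x)|\le d_2\frac{\|f\|_\infty}{\sqrt{|\lambda|}},\qquad x>0.$$ -/

import Mathlib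

open Set Filter Topology MeasureTheory
open scoped ENNReal

namespace DegenerateDiffusion

/-- The Banach space `C([0,∞])` of complex-valued continuous functions on the compact space
`[0,∞]`, that is, of continuous functions on `[0,∞[` that have a limit at infinity.
Its norm is the sup-norm. -/
abbrev CZeroInfty : Type := C(ℝ≥0∞, ℂ)

/-- The function of a real variable given by `u ∈ C([0,∞])`; only its values at `x ≥ 0` are used. -/
noncomputable def onReal (u : CZeroInfty) (x : ℝ) : ℂ := u (ENNReal.ofReal x)

/-- The kernel `p^{γ,b}(x,y,t)` for `b > 0` (and `x ≥ 0`, `y > 0`, `t > 0`). -/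
noncomputable def kernelPos (γ b x y t : ℝ) : ℝ :=
  (γ * t) ^ (-(b / γ)) * Real.exp (-((x + y) / (γ * t))) * y ^ (b / γ - 1) *
    ∑' m : ℕ, 1 / ((m.factorial : ℝ) * Real.Gamma ((m : ℝ) + b / γ)) *
      (x ^ m * y ^ m / (γ ^ (2 * m) * t ^ (2 * m)))

/-- The absolutely continuous part of the kernel `p^{γ,0}(x,y,t)`; its singular part is the point
mass `exp(-x/(γt)) δ₀`. -/
noncomputable def kernelZero (γ x y t : ℝ) : ℝ :=
  (γ * t)⁻¹ * Real.exp (-((x + y) / (γ * t))) *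
    ∑' m : ℕ, 1 / (((m + 1).factorial : ℝ) * (m.factorial : ℝ)) *
      (x ^ (m + 1) * y ^ m / (γ ^ (2 * m + 1) * t ^ (2 * m + 1)))

/-- The function `P_t^{γ,b} f`, at `x ≥ 0`, for `t > 0`. -/
noncomputable def semigroup (γ b t : ℝ) (f : CZeroInfty) (x : ℝ) : ℂ :=
  if b = 0 then
    (Real.exp (-(x / (γ * t))) : ℂ) * onReal f 0 +
      ∫ y in Ioi (0 : ℝ), (kernelZero γ x y t : ℂ) * onReal f y
  else
    ∫ y in Ioi (0 : ℝ), (kernelPos γ b x y t : ℂ) * onReal f y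

/-- The differential expression `γ x u''(x) + b u'(x)`, for `x > 0`. -/
noncomputable def diffExpr (γ b : ℝ) (u : ℝ → ℂ) (x : ℝ) : ℂ :=
  (γ * x : ℂ) * deriv (deriv u) x + (b : ℂ) * deriv u x

/-- The domain `D(A^{γ,b})`. -/
def InDomain (γ b : ℝ) (u : CZeroInfty) : Prop :=
  ContDiffOn ℝ 2 (onReal u) (Ioi 0) ∧
  Tendsto (diffExpr γ b (onReal u)) atTop (𝓝 0) ∧
  (b = 0 → Tendsto (diffExpr γ b (onReal u)) (𝓝[>] 0) (𝓝 0)) ∧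
  (b ≠ 0 → ContDiffOn ℝ 1 (onReal u) (Ici 0) ∧
    Tendsto (fun x : ℝ => (x : ℂ) * deriv (deriv (onReal u)) x) (𝓝[>] 0) (𝓝 0))

/-- `(u, v)` is in the graph of `A^{γ,b}`: `u ∈ D(A^{γ,b})` and `v = A^{γ,b} u` in `C([0,∞])`.
The values of `v` at `0` and `∞` are determined by continuity. -/
def IsImage (γ b : ℝ) (u v : CZeroInfty) : Prop :=
  InDomain γ b u ∧ ∀ x : ℝ, 0 < x → onReal v x = diffExpr γ b (onReal u) x

/-- `l` belongs to the resolvent set of `A^{γ,b}` and the bounded operator `R` is the resolvent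
`R(l, A^{γ,b})`, that is, the two-sided inverse of `l - A^{γ,b} : D(A^{γ,b}) → C([0,∞])`. -/
def IsResolvent (γ b : ℝ) (l : ℂ) (R : CZeroInfty →L[ℂ] CZeroInfty) : Prop :=
  (∀ f, ∃ v, IsImage γ b (R f) v ∧ l • R f - v = f) ∧
  (∀ u v, IsImage γ b u v → R (l • u - v) = u)

end DegenerateDiffusion

/-! Since `A^{γ,b} = γ A^{1,b/γ}`, everything reduces to `A = x∂² + β∂` with `β = b/γ ∈ [0, B/γ₀]`,
and only upper bounds on `β` enter the constants. Expanding the kernel shows that the semigroup is a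
mixture: draw `m` from the Poisson law of mean `x/t`, then average `f` against the Gamma law of
shape `β + m` and scale `t` (`semigroup_eq_diffSum`). Differentiating a Poisson average in its mean
replaces the sequence by its forward difference, and summation by parts turns differences into
polynomial weights. The Poisson variance then gives `√x |∂P_t f| ≤ ‖f‖/√t`, which is (1), and `‖A
P_t f‖ ≤ (2+2β)‖f‖/t`.

For (2) no general theory of analytic semigroups is used. On the span of the constants and the
exponentials `exp(-ξx)`, where `P_t` is explicit, `∂_t P_t u = P_t A u = A P_t u`. Applying
Duhamel's formula up to a time comparable to `1/|l|` bounds `|l| ‖u‖` by `‖(l - A)u‖` in a sector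
slightly larger than a half plane (`resolvent_estimate_core`). The same formula combined with the
gradient bound gives `√x |u'| ≤ ‖u‖/√t + 2√t ‖Au‖` (`sqrt_mul_norm_deriv_le`); `t = 1/|l|` makes
this the resolvent gradient estimate. Both estimates pass to the closure of the graph.

For surjectivity with `Re l > 0`, a functional annihilating the range, evaluated on exponentials,
solves a first-order linear ODE in `ξ` whose only admissible solution is zero
(`functional_eq_zero_of_range`); a Neumann series then reaches the whole sector
(`bijective_resolventMap`). Finally the closure is exactly the graph of `A` on the prescribed domain
(`mem_closedGraph_iff`): regularity of its elements comes from uniform convergence of derivatives,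
and the converse from the maximum principle. -/

namespace DegenerateDiffusion

/-! ### Poisson averages and their differences -/

/-- The weights `e^{-z} z^m / m!` of the Poisson distribution. -/
noncomputable def poissonWeight (z : ℝ) (m : ℕ) : ℝ := Real.exp (-z) * (z ^ m / m.factorial)

/-- The Poisson average `∑ e^{-z} z^m / m! c_m`. -/
noncomputable def poissonSum (c : ℕ → ℂ) (z : ℝ) : ℂ := ∑' m, poissonWeight z m • c m

/-- Forward difference of a sequence. -/
def fdiff (c : ℕ → ℂ) (m : ℕ) : ℂ := c (m + 1) - c m

lemma hasSum_of_eq {E : Type*} [NormedAddCommGroup E] {f g : ℕ → E} {a b : E} (h : HasSum f a)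
    (hf : ∀ m, g m = f m) (hb : b = a) : HasSum g b := by
  rw [hb, funext hf]; exact h

lemma poissonWeight_nonneg {z : ℝ} (hz : 0 ≤ z) (m : ℕ) : 0 ≤ poissonWeight z m := by
  unfold poissonWeight; positivity

lemma hasSum_pow_div_factorial (z : ℝ) :
    HasSum (fun m : ℕ => z ^ m / (m.factorial : ℝ)) (Real.exp z) := by
  rw [Real.exp_eq_exp_ℝ]
  exact NormedSpace.expSeries_div_hasSum_exp z

lemma hasSum_poissonWeight (z : ℝ) : HasSum (poissonWeight z) 1 := by
  have := (hasSum_pow_div_factorial z).mul_left (Real.exp (-z))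
  rwa [← Real.exp_add, neg_add_cancel, Real.exp_zero] at this

lemma succ_mul_poissonWeight (z : ℝ) (m : ℕ) :
    ((m + 1 : ℕ) : ℝ) * poissonWeight z (m + 1) = z * poissonWeight z m := by
  unfold poissonWeight
  have h1 : (m.factorial : ℝ) ≠ 0 := by positivity
  have h2 : (m : ℝ) + 1 ≠ 0 := by positivity
  rw [Nat.factorial_succ, pow_succ]; push_cast
  field_simp

/-- Comes from `m w_m = z w_{m-1}`. It produces both the Poisson moments and the summation by parts
below. -/
lemma hasSum_poissonWeight_shift {E : Type*} [NormedAddCommGroup E] [NormedSpace ℝ E]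
    {z : ℝ} {c : ℕ → E} {s : E} (h : HasSum (fun m => poissonWeight z m • c (m + 1)) s) :
    HasSum (fun m => poissonWeight z m • ((m : ℝ) • c m)) (z • s) := by
  rw [← hasSum_nat_add_iff' 1]
  simp only [Finset.range_one, Finset.sum_singleton, Nat.cast_zero, zero_smul, smul_zero, sub_zero]
  refine hasSum_of_eq (h.const_smul z) (fun m => ?_) rfl
  rw [smul_smul, smul_smul, mul_comm, succ_mul_poissonWeight]

lemma hasSum_poissonWeight_mul_nat (z : ℝ) :
    HasSum (fun m : ℕ => poissonWeight z m * m) z := by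
  simpa using hasSum_poissonWeight_shift (E := ℝ) (c := fun _ => 1) (z := z) (s := 1)
    (by simpa using hasSum_poissonWeight z)

lemma hasSum_poissonWeight_mul_sq (z : ℝ) :
    HasSum (fun m : ℕ => poissonWeight z m * (m : ℝ) ^ 2) (z ^ 2 + z) := by
  have h := hasSum_poissonWeight_shift (E := ℝ) (c := fun m => (m : ℝ)) (z := z) (s := z + 1) (by
    simpa [mul_add] using (hasSum_poissonWeight_mul_nat z).add (hasSum_poissonWeight z))
  refine hasSum_of_eq h (fun m => ?_) ?_
  · simp [sq]
  · rw [smul_eq_mul]; ring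

lemma hasSum_poissonWeight_mul_sub_sq (z : ℝ) :
    HasSum (fun m : ℕ => poissonWeight z m * ((m : ℝ) - z) ^ 2) z := by
  have h := ((hasSum_poissonWeight_mul_sq z).sub
    ((hasSum_poissonWeight_mul_nat z).mul_left (2 * z))).add
    ((hasSum_poissonWeight z).mul_left (z ^ 2))
  exact hasSum_of_eq h (fun m => by ring) (by ring)

section bounded

variable {c : ℕ → ℂ} {C : ℝ}

lemma fdiff_bound (hc : ∀ m, ‖c m‖ ≤ C) (m : ℕ) : ‖fdiff c m‖ ≤ 2 * C := by
  have := norm_sub_le (c (m + 1)) (c m)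
  have := hc m; have := hc (m + 1)
  unfold fdiff; linarith

lemma summable_poissonWeight_smul (hc : ∀ m, ‖c m‖ ≤ C) (z : ℝ) :
    Summable fun m => poissonWeight z m • c m := by
  refine Summable.of_norm_bounded (g := fun m => |poissonWeight z m| * C)
    ((hasSum_poissonWeight z).summable.abs.mul_right C) fun m => ?_
  rw [norm_smul, Real.norm_eq_abs]
  exact mul_le_mul_of_nonneg_left (hc m) (abs_nonneg _)

lemma hasSum_poissonSum (hc : ∀ m, ‖c m‖ ≤ C) (z : ℝ) :
    HasSum (fun m => poissonWeight z m • c m) (poissonSum c z) :=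
  (summable_poissonWeight_smul hc z).hasSum

lemma norm_poissonSum_le (hc : ∀ m, ‖c m‖ ≤ C) {z : ℝ} (hz : 0 ≤ z) : ‖poissonSum c z‖ ≤ C := by
  have h := (hasSum_poissonWeight z).mul_right C
  rw [one_mul] at h
  refine tsum_of_norm_bounded h fun m => ?_
  rw [norm_smul, Real.norm_of_nonneg (poissonWeight_nonneg hz m)]
  exact mul_le_mul_of_nonneg_left (hc m) (poissonWeight_nonneg hz m)

/-- Summation by parts: the difference is moved from the sequence to the weights, where it becomes
the centred factor `m - z`, whose size the variance controls. -/
lemma hasSum_poissonSum_fdiff (hc : ∀ m, ‖c m‖ ≤ C) (z : ℝ) :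
    HasSum (fun m : ℕ => poissonWeight z m • (((m : ℝ) - z) • c m))
      (z • poissonSum (fdiff c) z) := by
  have h0 := hasSum_poissonSum hc z
  have h1 := hasSum_poissonSum (c := fun m => c (m + 1)) (fun m => hc (m + 1)) z
  have h2 : poissonSum (fdiff c) z = poissonSum (fun m => c (m + 1)) z - poissonSum c z := by
    refine HasSum.tsum_eq ?_
    exact hasSum_of_eq (h1.sub h0) (fun m => by simp only [fdiff, smul_sub]) rfl
  rw [h2, smul_sub]
  refine hasSum_of_eq ((hasSum_poissonWeight_shift h1).sub (h0.const_smul z)) (fun m => ?_) rfl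
  rw [sub_smul, smul_sub, smul_comm (poissonWeight z m) z]

/-- Two summations by parts produce the second Charlier polynomial `(m - z)² - m`. -/
lemma hasSum_poissonSum_fdiff_fdiff (hc : ∀ m, ‖c m‖ ≤ C) (z : ℝ) :
    HasSum (fun m : ℕ => poissonWeight z m • ((((m : ℝ) - z) ^ 2 - m) • c m))
      (z • z • poissonSum (fdiff (fdiff c)) z) := by
  have h1 := hasSum_poissonSum_fdiff (fun m => hc (m + 1)) z
  have h0 := hasSum_poissonSum_fdiff hc z
  have h2 : poissonSum (fdiff (fdiff c)) z
      = poissonSum (fdiff fun m => c (m + 1)) z - poissonSum (fdiff c) z := by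
    refine HasSum.tsum_eq ?_
    exact hasSum_of_eq ((hasSum_poissonSum (c := fdiff fun m => c (m + 1))
      (fdiff_bound fun m => hc (m + 1)) z).sub (hasSum_poissonSum (fdiff_bound hc) z))
      (fun m => by simp only [fdiff, smul_sub]) rfl
  rw [h2, smul_sub, smul_sub]
  have h3 := hasSum_poissonWeight_shift (c := fun m : ℕ => ((m : ℝ) - 1 - z) • c m) (z := z)
    (hasSum_of_eq h1 (fun m => by simp only [Nat.cast_add, Nat.cast_one, add_sub_cancel_right]) rfl)
  refine hasSum_of_eq (h3.sub (h0.const_smul z)) (fun m => ?_) rfl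
  simp only [Complex.real_smul]; push_cast; ring

/-- The mean of `|m - z|` is at most `√z`, the standard deviation. The inequality `2√z |m - z| ≤ (m
- z)² + z`, applied termwise, replaces Cauchy–Schwarz. -/
lemma sqrt_mul_norm_poissonSum_fdiff_le (hc : ∀ m, ‖c m‖ ≤ C) {z : ℝ} (hz : 0 < z) :
    √z * ‖poissonSum (fdiff c) z‖ ≤ C := by
  have hs : 0 < √z := Real.sqrt_pos.2 hz
  have hss : √z * √z = z := Real.mul_self_sqrt hz.le
  have hb := (((hasSum_poissonWeight_mul_sub_sq z).mul_right (1 / √z)).add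
    ((hasSum_poissonWeight z).mul_right √z)).mul_right (C / 2)
  have key : ‖z • poissonSum (fdiff c) z‖ ≤ (z * (1 / √z) + 1 * √z) * (C / 2) := by
    rw [← (hasSum_poissonSum_fdiff hc z).tsum_eq]
    refine tsum_of_norm_bounded hb fun m => ?_
    rw [norm_smul, norm_smul, Real.norm_of_nonneg (poissonWeight_nonneg hz.le m), Real.norm_eq_abs]
    have hC := hc m
    have hC0 := (norm_nonneg _).trans hC
    have h1 : |(m : ℝ) - z| ≤ (((m : ℝ) - z) ^ 2 * (1 / √z) + √z) / 2 := by
      have : |(m : ℝ) - z| * (2 * √z) ≤ ((m : ℝ) - z) ^ 2 + √z * √z := by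
        nlinarith [sq_nonneg (|(m : ℝ) - z| - √z), sq_abs ((m : ℝ) - z)]
      have e : (((m : ℝ) - z) ^ 2 * (1 / √z) + √z) / 2
          = (((m : ℝ) - z) ^ 2 + √z * √z) / (2 * √z) := by field_simp
      rw [e, le_div_iff₀ (by positivity)]; exact this
    calc poissonWeight z m * (|(m : ℝ) - z| * ‖c m‖)
        ≤ poissonWeight z m * ((((m : ℝ) - z) ^ 2 * (1 / √z) + √z) / 2 * C) := by
          have := poissonWeight_nonneg hz.le m
          gcongr
      _ = _ := by ring
  rw [norm_smul, Real.norm_of_nonneg hz.le] at key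
  have e : (z * (1 / √z) + 1 * √z) * (C / 2) = √z * C := by
    have : z * (1 / √z) = √z := by rw [mul_one_div, Real.div_sqrt]
    rw [this]; ring
  rw [e] at key
  nth_rw 1 [← hss] at key
  rw [mul_assoc] at key
  exact le_of_mul_le_mul_left key hs

/-- The variance and the mean are both `z`, so `|(m - z)² - m|` has mean at most `2z`. -/
lemma mul_norm_poissonSum_fdiff_fdiff_le (hc : ∀ m, ‖c m‖ ≤ C) {z : ℝ} (hz : 0 < z) :
    z * ‖poissonSum (fdiff (fdiff c)) z‖ ≤ 2 * C := by
  have hb := ((hasSum_poissonWeight_mul_sub_sq z).add (hasSum_poissonWeight_mul_nat z)).mul_right C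
  have key : ‖z • z • poissonSum (fdiff (fdiff c)) z‖ ≤ (z + z) * C := by
    rw [← (hasSum_poissonSum_fdiff_fdiff hc z).tsum_eq]
    refine tsum_of_norm_bounded hb fun m => ?_
    rw [norm_smul, norm_smul, Real.norm_of_nonneg (poissonWeight_nonneg hz.le m), Real.norm_eq_abs]
    have hC := hc m
    have h1 : |((m : ℝ) - z) ^ 2 - m| ≤ ((m : ℝ) - z) ^ 2 + m := by
      rw [abs_le]; constructor <;> nlinarith [sq_nonneg ((m : ℝ) - z), (Nat.cast_nonneg m : (0:ℝ) ≤ m)]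
    calc poissonWeight z m * (|((m : ℝ) - z) ^ 2 - m| * ‖c m‖)
        ≤ poissonWeight z m * ((((m : ℝ) - z) ^ 2 + m) * C) := by
          have := poissonWeight_nonneg hz.le m
          gcongr
      _ = _ := by ring
  rw [norm_smul, norm_smul, Real.norm_of_nonneg hz.le] at key
  exact le_of_mul_le_mul_left (by linarith) hz

/-- The exponential series is differentiated termwise, which shifts the sequence; the factor
`e^{-z}` contributes the subtracted term of the difference. -/
lemma hasDerivAt_poissonSum (hc : ∀ m, ‖c m‖ ≤ C) (z : ℝ) :
    HasDerivAt (poissonSum c) (poissonSum (fdiff c) z) z := by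
  set g : (ℕ → ℂ) → ℝ → ℂ := fun d y => ∑' m : ℕ, (y ^ m / (m.factorial : ℝ)) • d m with hg
  have hC0 : 0 ≤ C := (norm_nonneg _).trans (hc 0)
  have hps : ∀ (d : ℕ → ℂ) (y : ℝ), poissonSum d y = Real.exp (-y) • g d y := by
    intro d y
    simp only [poissonSum, hg, poissonWeight]
    rw [← tsum_const_smul'']
    simp only [smul_smul]
  have hsum : ∀ y : ℝ, Summable fun m : ℕ => (y ^ m / (m.factorial : ℝ)) • c m := by
    intro y
    refine Summable.of_norm_bounded (g := fun m => |y ^ m / (m.factorial : ℝ)| * C)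
      ((hasSum_pow_div_factorial y).summable.abs.mul_right C) fun m => ?_
    rw [norm_smul, Real.norm_eq_abs]
    exact mul_le_mul_of_nonneg_left (hc m) (abs_nonneg _)
  have hterm : ∀ (m : ℕ) (y : ℝ), HasDerivAt (fun y : ℝ => (y ^ m / (m.factorial : ℝ)) • c m)
      ((m * y ^ (m - 1) / (m.factorial : ℝ)) • c m) y := fun m y =>
    ((hasDerivAt_pow m y).div_const _).smul_const _
  set R : ℝ := |z| + 1
  have hR : 0 < R := by positivity
  have hfac : ∀ (m : ℕ) (y : ℝ), ((m + 1 : ℕ) : ℝ) * y ^ (m + 1 - 1) / ((m + 1).factorial : ℝ)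
      = y ^ m / (m.factorial : ℝ) := by
    intro m y
    have h1 : (m.factorial : ℝ) ≠ 0 := by positivity
    have h2 : (m : ℝ) + 1 ≠ 0 := by positivity
    rw [Nat.factorial_succ, Nat.add_sub_cancel]; push_cast
    field_simp
  have hu : Summable fun m : ℕ => m * R ^ (m - 1) / (m.factorial : ℝ) * C := by
    refine Summable.mul_right C ?_
    rw [← summable_nat_add_iff 1]
    simp only [hfac]
    exact (hasSum_pow_div_factorial R).summable
  have hd : HasDerivAt (g c) (∑' m : ℕ, (m * z ^ (m - 1) / (m.factorial : ℝ)) • c m) z := by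
    refine hasDerivAt_tsum_of_isPreconnected hu (isOpen_Ioo (a := -R) (b := R))
      isPreconnected_Ioo (fun m y _ => hterm m y) (fun m y hy => ?_)
      (y₀ := 0) ⟨by linarith, by linarith⟩ (hsum 0) ?_
    · have hyR : |y| ≤ R := abs_le.2 ⟨hy.1.le, hy.2.le⟩
      rw [norm_smul, Real.norm_eq_abs, abs_div, abs_mul, abs_pow, Nat.abs_cast, Nat.abs_cast]
      have := hc m
      gcongr
    · exact abs_lt.1 (by simp [R])
  have hg1 : ∑' m : ℕ, (m * z ^ (m - 1) / (m.factorial : ℝ)) • c m = g (fun m => c (m + 1)) z := by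
    have hs : Summable fun m : ℕ => (m * z ^ (m - 1) / (m.factorial : ℝ)) • c m := by
      refine Summable.of_norm_bounded hu fun m => ?_
      rw [norm_smul, Real.norm_eq_abs, abs_div, abs_mul, abs_pow, Nat.abs_cast, Nat.abs_cast]
      have := hc m
      have : |z| ≤ R := by simp [R]
      gcongr
    rw [hs.tsum_eq_zero_add]
    simp only [hfac, hg]
    simp
  have h2 : poissonSum (fdiff c) z = poissonSum (fun m => c (m + 1)) z - poissonSum c z := by
    refine HasSum.tsum_eq ?_
    exact hasSum_of_eq ((hasSum_poissonSum (c := fun m => c (m + 1)) (fun m => hc (m + 1)) z).sub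
      (hasSum_poissonSum hc z)) (fun m => by simp only [fdiff, smul_sub]) rfl
  have hexp : HasDerivAt (fun y : ℝ => Real.exp (-y)) (-Real.exp (-z)) z := by
    simpa using (hasDerivAt_neg z).exp
  have := hexp.smul hd
  rw [show poissonSum c = fun y => Real.exp (-y) • g c y from funext (hps c), h2, hps, hps]
  refine this.congr_deriv ?_
  rw [hg1, neg_smul, sub_eq_add_neg]

lemma contDiff_one_poissonSum (hc : ∀ m, ‖c m‖ ≤ C) : ContDiff ℝ 1 (poissonSum c) := by
  rw [contDiff_one_iff_deriv]
  refine ⟨fun z => (hasDerivAt_poissonSum hc z).differentiableAt, ?_⟩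
  rw [show deriv (poissonSum c) = poissonSum (fdiff c) from
    funext fun z => (hasDerivAt_poissonSum hc z).deriv]
  exact continuous_iff_continuousAt.2 fun z =>
    (hasDerivAt_poissonSum (fdiff_bound hc) z).continuousAt

end bounded

lemma poissonSum_geom {r : ℝ} (A : ℂ) (z : ℝ) :
    poissonSum (fun m => (r : ℂ) ^ m * A) z = Real.exp (-(z * (1 - r))) * A := by
  have h := ((hasSum_pow_div_factorial (z * r)).mul_left (Real.exp (-z)))
  rw [← Real.exp_add] at h
  have h2 := (Complex.hasSum_ofReal.2 h).mul_right A
  refine HasSum.tsum_eq ?_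
  refine hasSum_of_eq h2 (fun m => ?_) ?_
  · simp only [poissonWeight, mul_pow, Complex.real_smul]; push_cast; ring
  · rw [show -(z * (1 - r)) = -z + z * r by ring]

/-! ### The space `C([0,∞])` and the exponentials -/

open ProbabilityTheory

lemma norm_onReal_le (f : CZeroInfty) (x : ℝ) : ‖onReal f x‖ ≤ ‖f‖ := f.norm_coe_le_norm _

lemma continuous_onReal (f : CZeroInfty) : Continuous (onReal f) :=
  f.continuous.comp ENNReal.continuous_ofReal

lemma tendsto_onReal_atTop (f : CZeroInfty) : Tendsto (onReal f) atTop (𝓝 (f ⊤)) :=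
  (f.continuous.tendsto ⊤).comp ENNReal.tendsto_ofReal_atTop

lemma onReal_toReal (f : CZeroInfty) {p : ℝ≥0∞} (hp : p ≠ ⊤) : onReal f p.toReal = f p := by
  rw [onReal, ENNReal.ofReal_toReal hp]

lemma norm_le_of_onReal {f : CZeroInfty} {C : ℝ} (h : ∀ x, 0 < x → ‖onReal f x‖ ≤ C) :
    ‖f‖ ≤ C := by
  have hC : 0 ≤ C := (norm_nonneg _).trans (h 1 one_pos)
  have h0 : ‖onReal f 0‖ ≤ C := by
    refine le_of_tendsto (((continuous_onReal f).norm.tendsto 0).mono_left nhdsWithin_le_nhds)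
      (?_ : ∀ᶠ x in 𝓝[>] (0 : ℝ), ‖onReal f x‖ ≤ C)
    filter_upwards [self_mem_nhdsWithin] with x hx using h x hx
  refine (ContinuousMap.norm_le _ hC).2 fun p => ?_
  by_cases hp : p = ⊤
  · rw [hp]
    refine le_of_tendsto (tendsto_onReal_atTop f).norm ?_
    filter_upwards [eventually_gt_atTop 0] with x hx using h x hx
  · rw [← onReal_toReal f hp]
    rcases (ENNReal.toReal_nonneg (a := p)).eq_or_lt with h1 | h1
    · rw [← h1]; exact h0
    · exact h _ h1

lemma ext_onReal {f g : CZeroInfty} (h : ∀ x, 0 < x → onReal f x = onReal g x) : f = g := by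
  rw [← sub_eq_zero, ← norm_le_zero_iff]
  exact norm_le_of_onReal fun x hx => by
    have := h x hx
    simp only [onReal] at this ⊢
    simp [this]

/-- Extension by `0` at infinity. -/
noncomputable def extendZero (g : ℝ → ℂ) (hg : Continuous g) (h : Tendsto g atTop (𝓝 0)) :
    CZeroInfty where
  toFun p := if p = ⊤ then 0 else g p.toReal
  continuous_toFun := by
    rw [continuous_iff_continuousAt]
    intro p
    by_cases hp : p = ⊤
    · subst hp
      rw [ContinuousAt, if_pos rfl, Metric.tendsto_nhds]
      intro ε hε
      obtain ⟨N, hN⟩ := eventually_atTop.1 ((Metric.tendsto_nhds.1 h) ε hε)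
      filter_upwards [lt_mem_nhds (ENNReal.ofReal_lt_top (r := N))] with p hp
      by_cases hp' : p = ⊤
      · simp [hp', hε]
      · rw [if_neg hp']
        exact hN _ ((ENNReal.ofReal_le_iff_le_toReal hp').1 hp.le)
    · have h1 : ContinuousAt (fun p : ℝ≥0∞ => g p.toReal) p :=
        hg.continuousAt.comp (ENNReal.tendsto_toReal hp)
      refine h1.congr ?_
      filter_upwards [isOpen_ne.mem_nhds hp] with q hq
      rw [if_neg hq]

lemma onReal_extendZero {g : ℝ → ℂ} {hg : Continuous g} {h : Tendsto g atTop (𝓝 0)} {x : ℝ}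
    (hx : 0 ≤ x) : onReal (extendZero g hg h) x = g x := by
  simp [onReal, extendZero, ENNReal.toReal_ofReal hx]

lemma extendZero_top {g : ℝ → ℂ} {hg : Continuous g} {h : Tendsto g atTop (𝓝 0)} :
    extendZero g hg h ⊤ = 0 := by
  simp [extendZero]

lemma tendsto_pow_mul_exp {ξ : ℝ} (hξ : 0 < ξ) (n : ℕ) :
    Tendsto (fun x : ℝ => ((x ^ n * Real.exp (-(ξ * x)) : ℝ) : ℂ)) atTop (𝓝 0) := by
  have := tendsto_rpow_mul_exp_neg_mul_atTop_nhds_zero n ξ hξ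
  simp only [Real.rpow_natCast, neg_mul] at this
  exact_mod_cast (Complex.continuous_ofReal.tendsto 0).comp this

/-- The function `x ^ n * exp (-ξ x)` for `ξ > 0`, as an element of `C([0,∞])`. -/
noncomputable def powExp (n : ℕ) (ξ : ℝ) : CZeroInfty :=
  if hξ : 0 < ξ then
    extendZero (fun x : ℝ => ((x ^ n * Real.exp (-(ξ * x)) : ℝ) : ℂ)) (by fun_prop)
      (tendsto_pow_mul_exp hξ n)
  else 0

lemma onReal_powExp (n : ℕ) {ξ x : ℝ} (hξ : 0 < ξ) (hx : 0 ≤ x) :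
    onReal (powExp n ξ) x = ((x ^ n * Real.exp (-(ξ * x)) : ℝ) : ℂ) := by
  rw [powExp, dif_pos hξ, onReal_extendZero hx]

lemma powExp_top (n : ℕ) {ξ : ℝ} (hξ : 0 < ξ) : powExp n ξ ⊤ = 0 := by
  rw [powExp, dif_pos hξ, extendZero_top]

lemma norm_powExp_zero_le {ξ : ℝ} (hξ : 0 < ξ) : ‖powExp 0 ξ‖ ≤ 1 := by
  refine norm_le_of_onReal fun x hx => ?_
  rw [onReal_powExp 0 hξ hx.le, pow_zero, one_mul, Complex.norm_real,
    Real.norm_of_nonneg (Real.exp_pos _).le, Real.exp_le_one_iff]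
  nlinarith

/-- A Taylor remainder uniform in `x`: half of the decay `exp(-ξx)` absorbs `exp(|h|x)`, the other
half absorbs `x²`. It makes `ξ ↦ exp(-ξ·)` differentiable in the sup-norm. -/
lemma abs_exp_sub_le (ξ h x : ℝ) (hξ : 0 < ξ) (hh : |h| ≤ ξ / 2) (hx : 0 ≤ x) :
    |Real.exp (-((ξ + h) * x)) - Real.exp (-(ξ * x)) + h * (x * Real.exp (-(ξ * x)))|
      ≤ 8 / ξ ^ 2 * h ^ 2 := by
  have h1 : |Real.exp (-(h * x)) - 1 + h * x| ≤ (h * x) ^ 2 * Real.exp (|h| * x) := by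
    have := Complex.norm_exp_sub_sum_le_norm_mul_exp ((-(h * x) : ℝ) : ℂ) 2
    simp only [Finset.sum_range_succ, Finset.sum_range_zero, ← Complex.ofReal_exp, Nat.factorial,
      Complex.norm_real, Real.norm_eq_abs] at this
    have e : (Real.exp (-(h * x)) : ℂ) - (0 + ((-(h * x) : ℝ) : ℂ) ^ 0 / ((1 : ℕ) : ℂ)
        + ((-(h * x) : ℝ) : ℂ) ^ 1 / (((0 + 1) * 1 : ℕ) : ℂ))
        = ((Real.exp (-(h * x)) - 1 + h * x : ℝ) : ℂ) := by
      push_cast; ring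
    rw [e, Complex.norm_real, Real.norm_eq_abs, abs_neg, sq_abs, abs_mul, abs_of_nonneg hx] at this
    exact this
  have h2 : (ξ / 2 * x) ^ 2 / 2 ≤ Real.exp (ξ / 2 * x) := by
    have := Real.quadratic_le_exp_of_nonneg (x := ξ / 2 * x) (by positivity)
    have : 0 ≤ ξ / 2 * x := by positivity
    linarith
  have e : Real.exp (-((ξ + h) * x)) - Real.exp (-(ξ * x)) + h * (x * Real.exp (-(ξ * x)))
      = Real.exp (-(ξ * x)) * (Real.exp (-(h * x)) - 1 + h * x) := by
    rw [show -((ξ + h) * x) = -(ξ * x) + -(h * x) by ring, Real.exp_add]; ring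
  rw [e, abs_mul, abs_of_pos (Real.exp_pos _)]
  calc Real.exp (-(ξ * x)) * |Real.exp (-(h * x)) - 1 + h * x|
      ≤ Real.exp (-(ξ * x)) * ((h * x) ^ 2 * Real.exp (ξ / 2 * x)) := by
        refine mul_le_mul_of_nonneg_left (h1.trans ?_) (Real.exp_pos _).le
        gcongr
    _ = (h * x) ^ 2 * Real.exp (-(ξ / 2 * x)) := by
        rw [show -(ξ / 2 * x) = -(ξ * x) + ξ / 2 * x by ring, Real.exp_add]; ring
    _ = 8 / ξ ^ 2 * h ^ 2 * ((ξ / 2 * x) ^ 2 / 2 * Real.exp (-(ξ / 2 * x))) := by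
        field_simp; ring
    _ ≤ 8 / ξ ^ 2 * h ^ 2 * (Real.exp (ξ / 2 * x) * Real.exp (-(ξ / 2 * x))) := by gcongr
    _ = 8 / ξ ^ 2 * h ^ 2 := by rw [← Real.exp_add]; simp

lemma hasDerivAt_powExp {ξ : ℝ} (hξ : 0 < ξ) :
    HasDerivAt (powExp 0) (-powExp 1 ξ) ξ := by
  rw [hasDerivAt_iff_isLittleO_nhds_zero]
  refine Asymptotics.IsBigO.trans_isLittleO (g := fun h : ℝ => h ^ 2)
    (Asymptotics.IsBigO.of_bound (8 / ξ ^ 2) ?_) (Asymptotics.isLittleO_pow_id one_lt_two)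
  have h1 : ∀ᶠ h : ℝ in 𝓝 0, |h| < ξ / 2 := by
    have := (continuous_abs (G := ℝ)).tendsto 0
    rw [abs_zero] at this
    exact this.eventually (gt_mem_nhds (by positivity))
  filter_upwards [h1] with h hh
  have hξh : 0 < ξ + h := by linarith [abs_lt.1 hh]
  rw [Real.norm_of_nonneg (sq_nonneg h)]
  refine norm_le_of_onReal fun x hx => ?_
  have e : onReal (powExp 0 (ξ + h) - powExp 0 ξ - h • -powExp 1 ξ) x
      = onReal (powExp 0 (ξ + h)) x - onReal (powExp 0 ξ) x + h * onReal (powExp 1 ξ) x := by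
    simp [onReal]
  rw [e, onReal_powExp 0 hξ hx.le, onReal_powExp 0 hξh hx.le, onReal_powExp 1 hξ hx.le]
  have := abs_exp_sub_le ξ h x hξ hh.le hx.le
  rw [← Real.norm_eq_abs, ← Complex.norm_real] at this
  convert! this using 2
  push_cast; ring

/-! ### The semigroup as a Poisson mixture of Gamma averages -/

/-- The Gamma distribution with shape `β + m` and scale `t`, degenerating to the Dirac mass at `0`
for shape `0`. -/
noncomputable def gammaLaw (β t : ℝ) (m : ℕ) : Measure ℝ :=
  -- For `β = m = 0` the Dirac mass supplies the atom of the kernel with `b = 0`. Using it for all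
  -- other bad parameters too makes every law a probability measure, so bounds on `coeff` need no
  -- hypotheses.
  if 0 < (m : ℝ) + β ∧ 0 < t then gammaMeasure (m + β) (1 / t) else Measure.dirac 0

instance (β t : ℝ) (m : ℕ) : IsProbabilityMeasure (gammaLaw β t m) := by
  unfold gammaLaw
  split_ifs with h
  · exact isProbabilityMeasure_gammaMeasure h.1 (by have := h.2; positivity)
  · infer_instance

lemma integrable_onReal (f : CZeroInfty) (μ : Measure ℝ) [IsFiniteMeasure μ] :
    Integrable (onReal f) μ :=
  (integrable_const (‖f‖ : ℝ)).mono' (continuous_onReal f).aestronglyMeasurable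
    (ae_of_all _ (norm_onReal_le f))

/-- The expectation of `f` under `gammaLaw β t m`. -/
noncomputable def coeff (β t : ℝ) (f : CZeroInfty) (m : ℕ) : ℂ := ∫ y, onReal f y ∂gammaLaw β t m

lemma norm_coeff_le (β t : ℝ) (f : CZeroInfty) (m : ℕ) : ‖coeff β t f m‖ ≤ ‖f‖ := by
  have := norm_integral_le_of_norm_le_const (μ := gammaLaw β t m) (ae_of_all _ (norm_onReal_le f))
  simpa [coeff] using this

lemma coeff_add (β t : ℝ) (f g : CZeroInfty) :
    coeff β t (f + g) = coeff β t f + coeff β t g :=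
  funext fun _ => integral_add (integrable_onReal f _) (integrable_onReal g _)

lemma coeff_smul (β t : ℝ) (c : ℂ) (f : CZeroInfty) :
    coeff β t (c • f) = c • coeff β t f :=
  funext fun _ => integral_const_mul c _

lemma iterate_fdiff_add (k : ℕ) (c d : ℕ → ℂ) :
    fdiff^[k] (c + d) = fdiff^[k] c + fdiff^[k] d := by
  induction k generalizing c d with
  | zero => rfl
  | succ k ih =>
    rw [Function.iterate_succ_apply, Function.iterate_succ_apply, Function.iterate_succ_apply, ← ih]
    congr 1; ext m; simp [fdiff]; ring

lemma iterate_fdiff_smul (k : ℕ) (a : ℂ) (c : ℕ → ℂ) :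
    fdiff^[k] (a • c) = a • fdiff^[k] c := by
  induction k generalizing c with
  | zero => rfl
  | succ k ih =>
    rw [Function.iterate_succ_apply, Function.iterate_succ_apply, ← ih]
    congr 1; ext m; simp [fdiff]; ring

lemma iterate_fdiff_bound {c : ℕ → ℂ} {C : ℝ} (hc : ∀ m, ‖c m‖ ≤ C) (k m : ℕ) :
    ‖fdiff^[k] c m‖ ≤ 2 ^ k * C := by
  induction k generalizing c C with
  | zero => simpa using hc m
  | succ k ih =>
    rw [Function.iterate_succ_apply, pow_succ, mul_assoc]
    exact ih (fdiff_bound hc)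

/-- The Poisson average at `x / t` of the `k`-th difference of the Gamma averages of `f`; for
`k = 0` this is the semigroup. -/
noncomputable def diffSum (k : ℕ) (β t x : ℝ) : CZeroInfty →ₗ[ℂ] ℂ where
  toFun f := poissonSum (fdiff^[k] (coeff β t f)) (x / t)
  map_add' f g := by
    rw [coeff_add, iterate_fdiff_add]
    exact HasSum.tsum_eq (hasSum_of_eq
      ((hasSum_poissonSum (iterate_fdiff_bound (norm_coeff_le β t f) k) _).add
      (hasSum_poissonSum (iterate_fdiff_bound (norm_coeff_le β t g) k) _))
      (fun m => by simp only [Pi.add_apply, smul_add]) rfl)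
  map_smul' c f := by
    rw [coeff_smul, iterate_fdiff_smul]
    refine HasSum.tsum_eq (hasSum_of_eq
      ((hasSum_poissonSum (iterate_fdiff_bound (norm_coeff_le β t f) k) _).const_smul c)
      (fun m => ?_) rfl)
    simp only [Pi.smul_apply]; rw [smul_comm]

lemma diffSum_apply (k : ℕ) (β t x : ℝ) (f : CZeroInfty) :
    diffSum k β t x f = poissonSum (fdiff^[k] (coeff β t f)) (x / t) := rfl

lemma norm_diffSum_zero_le (β : ℝ) {t x : ℝ} (ht : 0 < t) (hx : 0 ≤ x) (f : CZeroInfty) :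
    ‖diffSum 0 β t x f‖ ≤ ‖f‖ :=
  norm_poissonSum_le (norm_coeff_le β t f) (by positivity)

lemma hasDerivAt_diffSum_zero (β t x : ℝ) (f : CZeroInfty) :
    HasDerivAt (fun x => diffSum 0 β t x f) (t⁻¹ • diffSum 1 β t x f) x := by
  have h := hasDerivAt_poissonSum (norm_coeff_le β t f) (x / t)
  have h2 : HasDerivAt (fun y : ℝ => y / t) t⁻¹ x := by
    simpa using (hasDerivAt_id x).div_const t
  exact h.scomp x h2

lemma sqrt_mul_norm_diffSum_one_le (β : ℝ) {t x : ℝ} (ht : 0 < t) (hx : 0 ≤ x) (f : CZeroInfty) :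
    √x * ‖t⁻¹ • diffSum 1 β t x f‖ ≤ ‖f‖ / √t := by
  rcases hx.eq_or_lt with rfl | hx
  · rw [Real.sqrt_zero, zero_mul]; positivity
  have h := sqrt_mul_norm_poissonSum_fdiff_le (norm_coeff_le β t f) (div_pos hx ht)
  have hst : 0 < √t := Real.sqrt_pos.2 ht
  rw [norm_smul, norm_inv, Real.norm_of_nonneg ht.le, le_div_iff₀ hst]
  refine le_trans (le_of_eq ?_) h
  rw [diffSum_apply, Real.sqrt_div hx.le]
  have : t = √t * √t := (Real.mul_self_sqrt ht.le).symm
  have e : t⁻¹ * √t = (√t)⁻¹ := by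
    nth_rw 1 [this]; field_simp
  calc _ = √x * (t⁻¹ * √t) * ‖poissonSum (fdiff^[1] (coeff β t f)) (x / t)‖ := by ring
    _ = _ := by rw [e]; rfl

/-- The differential operator `x ∂² + β ∂` applied to the semigroup. -/
noncomputable def generatorSum (β t x : ℝ) : CZeroInfty →ₗ[ℂ] ℂ :=
  -- Each `∂` in `x` is `t⁻¹` times a difference, hence one factor `x/t` in the second-order term.
  (t⁻¹ : ℂ) • (((x / t : ℝ) : ℂ) • diffSum 2 β t x + (β : ℂ) • diffSum 1 β t x)

/-- The `1/t` bound on `A P_t` characteristic of analytic semigroups: the second difference costs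
`2`, the first costs `2β`. -/
lemma norm_generatorSum_le {β t x : ℝ} (hβ : 0 ≤ β) (ht : 0 < t) (hx : 0 < x) (f : CZeroInfty) :
    ‖generatorSum β t x f‖ ≤ (2 + 2 * β) / t * ‖f‖ := by
  have h1 := mul_norm_poissonSum_fdiff_fdiff_le (norm_coeff_le β t f) (div_pos hx ht)
  have h2 := norm_poissonSum_le (fdiff_bound (norm_coeff_le β t f)) (div_pos hx ht).le
  have hxt := div_pos hx ht
  simp only [generatorSum, LinearMap.smul_apply, LinearMap.add_apply, diffSum_apply, smul_eq_mul,
    norm_mul]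
  rw [norm_inv, Complex.norm_real, Real.norm_of_nonneg ht.le, 
    show (2 + 2 * β) / t * ‖f‖ = t⁻¹ * ((2 + 2 * β) * ‖f‖) by ring]
  refine mul_le_mul_of_nonneg_left ?_ (inv_nonneg.2 ht.le)
  refine (norm_add_le _ _).trans ?_
  rw [norm_mul, norm_mul, Complex.norm_real, Complex.norm_real, Real.norm_of_nonneg hxt.le,
    Real.norm_of_nonneg hβ]
  have h3 := mul_le_mul_of_nonneg_left h2 hβ
  have h4 := add_le_add h1 h3
  refine h4.trans (le_of_eq (by ring))

/-! ### The semigroup on exponentials -/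

lemma integral_gammaLaw {β t : ℝ} {m : ℕ} (hm : 0 < (m : ℝ) + β) (ht : 0 < t) (g : ℝ → ℂ) :
    ∫ y, g y ∂gammaLaw β t m = ∫ y in Ioi (0 : ℝ),
      ((1 / t) ^ ((m : ℝ) + β) / Real.Gamma (m + β) * y ^ ((m : ℝ) + β - 1)
        * Real.exp (-(1 / t * y))) • g y := by
  have hmeas : Measurable (gammaPDF (m + β) (1 / t)) := (measurable_gammaPDFReal _ _).ennreal_ofReal
  rw [gammaLaw, if_pos ⟨hm, ht⟩, gammaMeasure, integral_withDensity_eq_integral_toReal_smul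
    hmeas (ae_of_all _ fun _ => ENNReal.ofReal_lt_top)]
  have h0 : ∀ y ∉ Ici (0 : ℝ), (gammaPDF (m + β) (1 / t) y).toReal • g y = 0 := by
    intro y hy
    rw [gammaPDF_of_neg (by simpa using hy), ENNReal.toReal_zero, zero_smul]
  rw [← setIntegral_eq_integral_of_forall_compl_eq_zero h0, integral_Ici_eq_integral_Ioi]
  refine setIntegral_congr_fun measurableSet_Ioi fun y hy => ?_
  have hy' : 0 ≤ y := le_of_lt hy
  have hG := Real.Gamma_pos_of_pos hm
  rw [gammaPDF_of_nonneg hy', ENNReal.toReal_ofReal (by positivity)]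

lemma coeff_one (β t : ℝ) (m : ℕ) : coeff β t 1 m = 1 := by
  simp [coeff, onReal]

/-- The Laplace transform of the Gamma law. It is geometric in `m`, so its differences and Poisson
averages are explicit. -/
lemma coeff_powExp {β t ξ : ℝ} (hβ : 0 ≤ β) (ht : 0 < t) (hξ : 0 < ξ) (m : ℕ) :
    coeff β t (powExp 0 ξ) m = (((1 + t * ξ)⁻¹ : ℝ) : ℂ) ^ m * (((1 + t * ξ) ^ (-β) : ℝ) : ℂ) := by
  have h1 : 0 < 1 + t * ξ := by positivity
  have e1 : (((1 + t * ξ)⁻¹ : ℝ) : ℂ) ^ m * (((1 + t * ξ) ^ (-β) : ℝ) : ℂ)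
      = (((1 + t * ξ) ^ (-((m : ℝ) + β)) : ℝ) : ℂ) := by
    rw [neg_add, Real.rpow_add h1, Real.rpow_neg h1.le (m : ℝ), Real.rpow_natCast]
    push_cast; rw [inv_pow]
  rw [e1]
  have hm0 : 0 ≤ (m : ℝ) + β := by positivity
  rcases hm0.eq_or_lt with hm | hm
  · rw [coeff, gammaLaw, if_neg (fun h => h.1.ne hm), integral_dirac, onReal_powExp 0 hξ le_rfl,
      ← hm]
    simp
  · rw [coeff, integral_gammaLaw hm ht]
    have hG := (Real.Gamma_pos_of_pos hm).ne'
    have : ∀ y ∈ Ioi (0 : ℝ), ((1 / t) ^ ((m : ℝ) + β) / Real.Gamma (m + β)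
        * y ^ ((m : ℝ) + β - 1) * Real.exp (-(1 / t * y))) • onReal (powExp 0 ξ) y
        = (((1 / t) ^ ((m : ℝ) + β) / Real.Gamma (m + β)
        * (y ^ ((m : ℝ) + β - 1) * Real.exp (-((1 / t + ξ) * y))) : ℝ) : ℂ) := by
      intro y hy
      rw [onReal_powExp 0 hξ (le_of_lt hy), Complex.real_smul, ← Complex.ofReal_mul]
      rw [show -((1 / t + ξ) * y) = -(1 / t * y) + -(ξ * y) by ring, Real.exp_add]
      congr 1; ring
    rw [setIntegral_congr_fun measurableSet_Ioi this, integral_complex_ofReal,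
      integral_const_mul, Real.integral_rpow_mul_exp_neg_mul_Ioi hm (by positivity)]
    congr 1
    have h2 : 1 / t + ξ = (1 + t * ξ) * (1 / t) := by field_simp
    rw [h2, Real.rpow_neg h1.le, Real.div_rpow zero_le_one (x := 1) (y := (1 + t * ξ) * (1 / t)) (by positivity), Real.one_rpow,
      Real.mul_rpow h1.le (by positivity)]
    have h3 : (1 / t) ^ ((m : ℝ) + β) ≠ 0 := (Real.rpow_pos_of_pos (by positivity) _).ne'
    have h4 : (1 + t * ξ) ^ ((m : ℝ) + β) ≠ 0 := (Real.rpow_pos_of_pos h1 _).ne'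
    field_simp

lemma iterate_fdiff_geom (k : ℕ) (r A : ℂ) :
    fdiff^[k] (fun m => r ^ m * A) = fun m => r ^ m * ((r - 1) ^ k * A) := by
  induction k generalizing A with
  | zero => simp
  | succ k ih =>
    have : fdiff (fun m => r ^ m * A) = fun m => r ^ m * ((r - 1) * A) := by
      ext m; simp only [fdiff]; ring
    rw [Function.iterate_succ_apply, this, ih]
    ext m; ring

/-- The semigroup applied to `exp (-ξ ·)`. -/
noncomputable def expFlow (β t ξ x : ℝ) : ℝ :=
  (1 + t * ξ) ^ (-β) * Real.exp (-(x * ξ / (1 + t * ξ)))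

lemma diffSum_powExp (k : ℕ) {β t ξ : ℝ} (hβ : 0 ≤ β) (ht : 0 < t) (hξ : 0 < ξ) (x : ℝ) :
    diffSum k β t x (powExp 0 ξ) = ((((1 + t * ξ)⁻¹ - 1) ^ k * expFlow β t ξ x : ℝ) : ℂ) := by
  have h1 : 0 < 1 + t * ξ := by positivity
  rw [diffSum_apply, show coeff β t (powExp 0 ξ) = _ from funext (coeff_powExp hβ ht hξ),
    iterate_fdiff_geom, poissonSum_geom, expFlow]
  rw [show x / t * (1 - (1 + t * ξ)⁻¹) = x * ξ / (1 + t * ξ) by field_simp; ring]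
  push_cast; ring

lemma diffSum_one (k : ℕ) (β t x : ℝ) : diffSum k β t x 1 = 0 ^ k := by
  have : coeff β t 1 = fun m => ((1 : ℝ) : ℂ) ^ m * 1 := by ext m; simp [coeff_one]
  rw [diffSum_apply, this, iterate_fdiff_geom, poissonSum_geom]
  simp

lemma hasDerivAt_expFlow_left {β t ξ : ℝ} (ht : 0 ≤ t) (hξ : 0 < ξ) (x : ℝ) :
    HasDerivAt (fun t => expFlow β t ξ x)
      (expFlow β t ξ x * (-(β * ξ / (1 + t * ξ)) + x * ξ ^ 2 / (1 + t * ξ) ^ 2)) t := by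
  have h1 : 0 < 1 + t * ξ := by positivity
  have hl : HasDerivAt (fun t : ℝ => 1 + t * ξ) ξ t := by
    simpa using ((hasDerivAt_id t).mul_const ξ).const_add 1
  have h2 := hl.rpow_const (p := -β) (Or.inl h1.ne')
  have h3 := ((((hasDerivAt_const t (x * ξ)).div hl h1.ne').neg).exp)
  refine (h2.mul h3).congr_deriv ?_
  rw [expFlow, Real.rpow_sub_one h1.ne']
  simp only [Pi.neg_apply, Pi.div_apply]
  field_simp
  ring

lemma hasDerivAt_expFlow_right {β t ξ : ℝ} (ht : 0 ≤ t) (hξ : 0 < ξ) (x : ℝ) :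
    HasDerivAt (fun ξ => expFlow β t ξ x)
      (-(expFlow β t ξ x * (β * t / (1 + t * ξ) + x / (1 + t * ξ) ^ 2))) ξ := by
  have h1 : 0 < 1 + t * ξ := by positivity
  have hl : HasDerivAt (fun ξ : ℝ => 1 + t * ξ) t ξ := by
    simpa using ((hasDerivAt_id ξ).const_mul t).const_add 1
  have h2 := hl.rpow_const (p := -β) (Or.inl h1.ne')
  have hx : HasDerivAt (fun ξ : ℝ => x * ξ) x ξ := by
    simpa using (hasDerivAt_id ξ).const_mul x
  have h3 := (((hx.div hl h1.ne').neg).exp)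
  refine (h2.mul h3).congr_deriv ?_
  rw [expFlow, Real.rpow_sub_one h1.ne']
  simp only [Pi.neg_apply, Pi.div_apply]
  field_simp
  ring

/-- Obtained by differentiating the formula for `exp(-ξ·)` in `ξ`, since the semigroup at a point is
a bounded functional. -/
lemma diffSum_powExp_one {β t ξ x : ℝ} (hβ : 0 ≤ β) (ht : 0 < t) (hξ : 0 < ξ) (hx : 0 ≤ x) :
    diffSum 0 β t x (powExp 1 ξ)
      = ((expFlow β t ξ x * (β * t / (1 + t * ξ) + x / (1 + t * ξ) ^ 2) : ℝ) : ℂ) := by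
  let L : CZeroInfty →L[ℂ] ℂ := (diffSum 0 β t x).mkContinuous 1 fun f => by
    rw [one_mul]; exact norm_diffSum_zero_le β ht hx f
  have h1 : HasDerivAt (fun η => L (powExp 0 η)) (L (-powExp 1 ξ)) ξ :=
    (L.restrictScalars ℝ).hasFDerivAt.comp_hasDerivAt ξ (hasDerivAt_powExp hξ)
  have h2 := (hasDerivAt_expFlow_right (β := β) ht.le hξ x).ofReal_comp
  have h3 : (fun η => L (powExp 0 η)) =ᶠ[𝓝 ξ] fun η => (expFlow β t η x : ℂ) := by
    filter_upwards [lt_mem_nhds hξ] with η hη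
    change diffSum 0 β t x (powExp 0 η) = _
    rw [diffSum_powExp 0 hβ ht hη]; simp
  have h4 := h1.unique (h2.congr_of_eventuallyEq h3)
  rw [map_neg, Complex.ofReal_neg, neg_inj] at h4
  exact h4

/-- The image of `exp (-ξ ·)` under `x ∂² + β ∂`. -/
noncomputable def genExp (β ξ : ℝ) : CZeroInfty :=
  ((ξ ^ 2 : ℝ) : ℂ) • powExp 1 ξ - ((β * ξ : ℝ) : ℂ) • powExp 0 ξ

lemma onReal_genExp (β : ℝ) {ξ x : ℝ} (hξ : 0 < ξ) (hx : 0 ≤ x) :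
    onReal (genExp β ξ) x = (((x * ξ ^ 2 - β * ξ) * Real.exp (-(ξ * x)) : ℝ) : ℂ) := by
  have : onReal (genExp β ξ) x = ((ξ ^ 2 : ℝ) : ℂ) * onReal (powExp 1 ξ) x
      - ((β * ξ : ℝ) : ℂ) * onReal (powExp 0 ξ) x := rfl
  rw [this, onReal_powExp 0 hξ hx, onReal_powExp 1 hξ hx]
  push_cast; ring

lemma diffSum_genExp {β t ξ x : ℝ} (hβ : 0 ≤ β) (ht : 0 < t) (hξ : 0 < ξ) (hx : 0 ≤ x) :
    diffSum 0 β t x (genExp β ξ) = ((expFlow β t ξ x *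
      (-(β * ξ / (1 + t * ξ)) + x * ξ ^ 2 / (1 + t * ξ) ^ 2) : ℝ) : ℂ) := by
  have h1 : 1 + t * ξ ≠ 0 := by positivity
  rw [genExp, map_sub, map_smul, map_smul, diffSum_powExp_one hβ ht hξ hx,
    diffSum_powExp 0 hβ ht hξ, smul_eq_mul, smul_eq_mul, ← Complex.ofReal_mul,
    ← Complex.ofReal_mul, ← Complex.ofReal_sub]
  congr 1
  field_simp
  ring

/-- The commutation `A P_t = P_t A` on exponentials; both sides are explicit. -/
lemma generatorSum_powExp {β t ξ x : ℝ} (hβ : 0 ≤ β) (ht : 0 < t) (hξ : 0 < ξ) (hx : 0 ≤ x) :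
    generatorSum β t x (powExp 0 ξ) = diffSum 0 β t x (genExp β ξ) := by
  have h1 : 1 + t * ξ ≠ 0 := by positivity
  rw [diffSum_genExp hβ ht hξ hx]
  simp only [generatorSum, LinearMap.smul_apply, LinearMap.add_apply, diffSum_powExp _ hβ ht hξ,
    smul_eq_mul]
  rw [← Complex.ofReal_mul, ← Complex.ofReal_mul, ← Complex.ofReal_add, ← Complex.ofReal_inv,
    ← Complex.ofReal_mul]
  congr 1
  field_simp
  ring

/-! ### The core, its flow and the closure of its graph -/

/-- The linear span of the pairs `(u, (x ∂² + β ∂) u)`, where `u` is constant or an exponential. -/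
noncomputable def coreGraph (β : ℝ) : Submodule ℂ (CZeroInfty × CZeroInfty) :=
  Submodule.span ℂ (insert (1, 0) ((fun ξ => (powExp 0 ξ, genExp β ξ)) '' Ioi 0))

lemma coreGraph_induction {β : ℝ} {P : CZeroInfty × CZeroInfty → Prop} (h1 : P (1, 0))
    (he : ∀ ξ > 0, P (powExp 0 ξ, genExp β ξ)) (h0 : P 0) (ha : ∀ p q, P p → P q → P (p + q))
    (hs : ∀ (c : ℂ) p, P p → P (c • p)) : ∀ p ∈ coreGraph β, P p := by
  intro p hp
  refine Submodule.span_induction (p := fun p _ => P p) ?_ h0 (fun p q _ _ => ha p q)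
    (fun c p _ => hs c p) hp
  rintro _ (rfl | ⟨ξ, hξ, rfl⟩)
  · exact h1
  · exact he ξ hξ

lemma diffSum_eq_generatorSum {β t x : ℝ} (hβ : 0 ≤ β) (ht : 0 < t) (hx : 0 ≤ x) :
    ∀ p ∈ coreGraph β, diffSum 0 β t x p.2 = generatorSum β t x p.1 := by
  refine coreGraph_induction ?_ (fun ξ hξ => (generatorSum_powExp hβ ht hξ hx).symm) ?_ ?_ ?_
  · simp [generatorSum, diffSum_one]
  · simp
  · intro p q hp hq; simp only [Prod.fst_add, Prod.snd_add, map_add, hp, hq]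
  · intro c p hp; simp only [Prod.smul_fst, Prod.smul_snd, map_smul, hp]

lemma hasDerivAt_diffSum_time {β t x : ℝ} (hβ : 0 ≤ β) (ht : 0 < t) (hx : 0 ≤ x) :
    ∀ p ∈ coreGraph β,
      HasDerivAt (fun s => diffSum 0 β s x p.1) (diffSum 0 β t x p.2) t := by
  refine coreGraph_induction ?_ (fun ξ hξ => ?_) ?_ ?_ ?_
  · simpa [diffSum_one] using hasDerivAt_const t (1 : ℂ)
  · simp only
    rw [diffSum_genExp hβ ht hξ hx]
    refine (hasDerivAt_expFlow_left ht.le hξ x).ofReal_comp.congr_of_eventuallyEq ?_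
    filter_upwards [lt_mem_nhds ht] with s hs
    rw [diffSum_powExp 0 hβ hs hξ]; simp
  · simpa using hasDerivAt_const t (0 : ℂ)
  · intro p q hp hq
    simp only [Prod.fst_add, Prod.snd_add, map_add]
    exact hp.add hq
  · intro c p hp
    simp only [Prod.smul_fst, Prod.smul_snd, map_smul]
    exact hp.const_smul c

lemma tendsto_diffSum_zero {β x : ℝ} (hβ : 0 ≤ β) (hx : 0 ≤ x) :
    ∀ p ∈ coreGraph β, Tendsto (fun s => diffSum 0 β s x p.1) (𝓝[>] 0) (𝓝 (onReal p.1 x)) := by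
  refine coreGraph_induction ?_ (fun ξ hξ => ?_) ?_ ?_ ?_
  · simp [diffSum_one, onReal]
  · have h := ((hasDerivAt_expFlow_left (β := β) le_rfl hξ x).ofReal_comp.continuousAt.tendsto).mono_left
      (nhdsWithin_le_nhds (s := Ioi 0))
    have e : ((expFlow β 0 ξ x : ℝ) : ℂ) = onReal (powExp 0 ξ) x := by
      rw [onReal_powExp 0 hξ hx, expFlow]; simp [mul_comm]
    rw [e] at h
    refine h.congr' ?_
    filter_upwards [self_mem_nhdsWithin] with s hs
    rw [diffSum_powExp 0 hβ hs hξ]; simp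
  · simp [onReal]
  · intro p q hp hq
    simp only [Prod.fst_add, map_add]
    exact hp.add hq
  · intro c p hp
    simp only [Prod.smul_fst, map_smul]
    exact hp.const_smul c

/-- `U` is a smooth representative of `u`, and `v = x U'' + β U'`. -/
structure IsSmoothPair (β : ℝ) (U U₁ U₂ : ℝ → ℂ) (p : CZeroInfty × CZeroInfty) : Prop where
  hasDerivAt : ∀ x, HasDerivAt U (U₁ x) x
  hasDerivAt' : ∀ x, HasDerivAt U₁ (U₂ x) x
  eq_fst : ∀ x, 0 ≤ x → onReal p.1 x = U x
  eq_snd : ∀ x, 0 ≤ x → onReal p.2 x = x * U₂ x + β * U₁ x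
  top : p.2 ⊤ = 0

lemma exists_isSmoothPair {β : ℝ} :
    ∀ p ∈ coreGraph β, ∃ U U₁ U₂, IsSmoothPair β U U₁ U₂ p := by
  refine coreGraph_induction ?_ (fun ξ hξ => ?_) ?_ ?_ ?_
  · exact ⟨fun _ => 1, fun _ => 0, fun _ => 0, fun x => hasDerivAt_const x _,
      fun x => hasDerivAt_const x _, by simp [onReal], by simp [onReal], rfl⟩
  · have hd : ∀ x : ℝ, HasDerivAt (fun x : ℝ => Real.exp (-(ξ * x)))
        (-ξ * Real.exp (-(ξ * x))) x := fun x => by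
      have h2 : HasDerivAt (fun y : ℝ => -(ξ * y)) (-(ξ * 1)) x :=
        ((hasDerivAt_id x).const_mul ξ).neg
      simpa [mul_comm] using h2.exp
    refine ⟨fun x => (Real.exp (-(ξ * x)) : ℝ), fun x => (-ξ * Real.exp (-(ξ * x)) : ℝ),
      fun x => (-ξ * (-ξ * Real.exp (-(ξ * x))) : ℝ), fun x => (hd x).ofReal_comp,
      fun x => ((hd x).const_mul (-ξ)).ofReal_comp, fun x hx => ?_, fun x hx => ?_, ?_⟩
    · rw [onReal_powExp 0 hξ hx]; simp
    · rw [onReal_genExp β hξ hx]; push_cast; ring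
    · simp [genExp, powExp_top _ hξ]
  · exact ⟨fun _ => 0, fun _ => 0, fun _ => 0, fun x => hasDerivAt_const x _,
      fun x => hasDerivAt_const x _, by simp [onReal], by simp [onReal], rfl⟩
  · rintro p q ⟨U, U₁, U₂, hU⟩ ⟨V, V₁, V₂, hV⟩
    refine ⟨U + V, U₁ + V₁, U₂ + V₂, fun x => (hU.1 x).add (hV.1 x),
      fun x => (hU.2 x).add (hV.2 x), fun x hx => ?_, fun x hx => ?_, ?_⟩
    · exact congr_arg₂ (· + ·) (hU.3 x hx) (hV.3 x hx)
    · refine (congr_arg₂ (· + ·) (hU.4 x hx) (hV.4 x hx)).trans ?_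
      simp only [Pi.add_apply]; ring
    · simp [hU.5, hV.5]
  · rintro c p ⟨U, U₁, U₂, hU⟩
    refine ⟨c • U, c • U₁, c • U₂, fun x => (hU.1 x).const_smul c,
      fun x => (hU.2 x).const_smul c, fun x hx => ?_, fun x hx => ?_, ?_⟩
    · exact congr_arg (c * ·) (hU.3 x hx)
    · refine (congr_arg (c * ·) (hU.4 x hx)).trans ?_
      simp only [Pi.smul_apply, smul_eq_mul]; ring
    · simp [hU.5]

/-- The closure of `coreGraph β`, which turns out to be the graph of `A^{1,β}`. -/
noncomputable def closedGraph (β : ℝ) : Submodule ℂ (CZeroInfty × CZeroInfty) :=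
  (coreGraph β).topologicalClosure

lemma isClosed_closedGraph (β : ℝ) :
    IsClosed (closedGraph β : Set (CZeroInfty × CZeroInfty)) :=
  Submodule.isClosed_topologicalClosure _

lemma closedGraph_le {β : ℝ} {S : Set (CZeroInfty × CZeroInfty)} (hS : IsClosed S)
    (h : ∀ p ∈ coreGraph β, p ∈ S) : ∀ p ∈ closedGraph β, p ∈ S := fun _ hp =>
  closure_minimal h hS hp

lemma coreGraph_le_closedGraph (β : ℝ) : coreGraph β ≤ closedGraph β :=
  Submodule.le_topologicalClosure _

@[fun_prop]
lemma continuous_onReal_left (x : ℝ) : Continuous fun u : CZeroInfty => onReal u x :=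
  continuous_eval_const (F := CZeroInfty) _

/-! ### A priori estimates on the resolvent and the gradient -/

/-- With `f = (l - A)u`, the function `e^{-ls} P_s u` has derivative `-e^{-ls} P_s f`, so `u`
differs from `e^{-lt} P_t u` by at most `2t‖f‖`. The end term is small because `l P_t u = P_t f + A
P_t u` and `‖A P_t u‖ ≤ M‖u‖/t`. -/
lemma resolvent_estimate_core {β M : ℝ} (hβ : 0 ≤ β) (hM : 2 + 2 * β ≤ M) {l : ℂ} (hl : l ≠ 0)
    (hs : -(‖l‖ / (8 * M)) ≤ l.re) {p : CZeroInfty × CZeroInfty} (hp : p ∈ coreGraph β) :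
    ‖l‖ * ‖p.1‖ ≤ (4 + 16 * M) * ‖l • p.1 - p.2‖ := by
  have hM0 : 0 < M := by linarith
  have hl0 : 0 < ‖l‖ := norm_pos_iff.2 hl
  set f := l • p.1 - p.2 with hf
  -- Then `M/t = |l|/4`, so after the factor 2 the term in `u` is `(|l|/2)‖u‖` and can be absorbed.
  -- The sector condition gives `-Re(l) s ≤ 1/2` for `s ≤ t`.
  set t := 4 * M / ‖l‖ with htdef
  have ht : 0 < t := by positivity
  have hexp : ∀ s, 0 ≤ s → s ≤ t → ‖Complex.exp (-(l * s))‖ ≤ 2 := by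
    intro s hs0 hst
    rw [Complex.norm_exp]
    have h1 : (-(l * s)).re ≤ 1 / 2 := by
      have : (-(l * s)).re = -l.re * s := by simp
      rw [this]
      calc -l.re * s ≤ ‖l‖ / (8 * M) * t :=
            mul_le_mul (by linarith) hst hs0 (by positivity)
        _ = 1 / 2 := by rw [htdef]; field_simp; norm_num
    calc Real.exp (-(l * s)).re ≤ Real.exp (1 / 2) := Real.exp_le_exp.2 h1
      _ ≤ 2 := by
        have h2 : Real.exp (1 / 2) * Real.exp (1 / 2) = Real.exp 1 := by
          rw [← Real.exp_add]; norm_num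
        nlinarith [Real.exp_one_lt_d9, Real.exp_pos (1 / 2)]
  have key : ∀ x, 0 < x → ‖onReal p.1 x‖ ≤
      (2 * ‖f‖ + ‖l‖ / 2 * ‖p.1‖ + 8 * M * ‖f‖) / ‖l‖ := by
    intro x hx
    set φ : ℝ → ℂ := fun s => Complex.exp (-(l * s)) * diffSum 0 β s x p.1 with hφ
    have hdexp : ∀ s : ℝ, HasDerivAt (fun s : ℝ => Complex.exp (-(l * s)))
        (Complex.exp (-(l * s)) * -l) s := by
      intro s
      have h1 : HasDerivAt (fun s : ℝ => -(l * (s : ℂ))) (-(l * 1)) s :=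
        ((Complex.ofRealCLM.hasDerivAt (x := s)).const_mul l).neg
      simpa using h1.cexp
    have hd : ∀ s ∈ Ioc 0 t, HasDerivWithinAt φ
        (-(Complex.exp (-(l * s)) * diffSum 0 β s x f)) (Ioc 0 t) s := by
      intro s hs'
      refine (((hdexp s).mul (hasDerivAt_diffSum_time hβ hs'.1 hx.le p hp)).congr_deriv
        ?_).hasDerivWithinAt
      rw [hf, map_sub, map_smul, smul_eq_mul]; ring
    have hb : ∀ s ∈ Ioc 0 t, ‖-(Complex.exp (-(l * s)) * diffSum 0 β s x f)‖ ≤ 2 * ‖f‖ := by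
      intro s hs'
      rw [norm_neg, norm_mul]
      exact mul_le_mul (hexp s hs'.1.le hs'.2) (norm_diffSum_zero_le β hs'.1 hx.le f)
        (norm_nonneg _) (by norm_num)
    have hmv : ∀ s ∈ Ioc 0 t, ‖φ t - φ s‖ ≤ 2 * ‖f‖ * t := by
      intro s hs'
      refine ((convex_Ioc 0 t).norm_image_sub_le_of_norm_hasDerivWithin_le hd hb hs'
        ⟨ht, le_rfl⟩).trans ?_
      gcongr
      rw [Real.norm_of_nonneg (by linarith [hs'.2])]; linarith [hs'.1]
    have hlim : Tendsto φ (𝓝[>] 0) (𝓝 (onReal p.1 x)) := by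
      have h1 := ((hdexp 0).continuousAt.tendsto.mono_left
        (nhdsWithin_le_nhds (s := Ioi 0))).mul (tendsto_diffSum_zero hβ hx.le p hp)
      simpa using h1
    have h2 : ‖φ t - onReal p.1 x‖ ≤ 2 * ‖f‖ * t := by
      refine le_of_tendsto (hlim.const_sub (φ t)).norm ?_
      filter_upwards [Ioc_mem_nhdsGT ht] with s hs' using hmv s hs'
    have h3 : ‖φ t‖ ≤ 2 * ‖diffSum 0 β t x p.1‖ := by
      rw [hφ, norm_mul]
      exact mul_le_mul_of_nonneg_right (hexp t ht.le le_rfl) (norm_nonneg _)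
    have h4 : ‖l‖ * ‖diffSum 0 β t x p.1‖ ≤ ‖f‖ + M / t * ‖p.1‖ := by
      have e : l * diffSum 0 β t x p.1 = diffSum 0 β t x f + generatorSum β t x p.1 := by
        rw [← diffSum_eq_generatorSum hβ ht hx.le p hp, hf, map_sub, map_smul, smul_eq_mul]; ring
      rw [← norm_mul, e]
      refine (norm_add_le _ _).trans (add_le_add (norm_diffSum_zero_le β ht hx.le f) ?_)
      refine (norm_generatorSum_le hβ ht hx p.1).trans ?_
      gcongr
    have h5 : ‖onReal p.1 x‖ ≤ ‖φ t‖ + 2 * ‖f‖ * t := by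
      have := norm_sub_norm_le (onReal p.1 x) (φ t)
      rw [norm_sub_rev] at this
      linarith
    have h6 : M / t = ‖l‖ / 4 := by rw [htdef]; field_simp
    have h7 : ‖l‖ * t = 4 * M := by rw [htdef]; field_simp
    rw [h6] at h4
    rw [le_div_iff₀ hl0]
    have h8 : ‖l‖ * (2 * ‖f‖ * t) = 8 * M * ‖f‖ := by
      calc _ = 2 * ‖f‖ * (‖l‖ * t) := by ring
        _ = _ := by rw [h7]; ring
    have h9 := mul_le_mul_of_nonneg_left (h5.trans (add_le_add_left h3 _)) hl0.le
    nlinarith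
  have h := norm_le_of_onReal key
  rw [le_div_iff₀ hl0] at h
  nlinarith

lemma resolvent_estimate {β M : ℝ} (hβ : 0 ≤ β) (hM : 2 + 2 * β ≤ M) {l : ℂ} (hl : l ≠ 0)
    (hs : -(‖l‖ / (8 * M)) ≤ l.re) : ∀ p ∈ closedGraph β,
    ‖l‖ * ‖p.1‖ ≤ (4 + 16 * M) * ‖l • p.1 - p.2‖ :=
  closedGraph_le (S := {p | ‖l‖ * ‖p.1‖ ≤ (4 + 16 * M) * ‖l • p.1 - p.2‖})
    (isClosed_le (by fun_prop) (by fun_prop))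
    fun _ hp => resolvent_estimate_core hβ hM hl hs hp

/-- In the variable `r = √x` the weighted gradient bound is an ordinary Lipschitz bound, valid up to
the boundary. -/
lemma lipschitz_diffSum_sq (β : ℝ) {t : ℝ} (ht : 0 < t) (f : CZeroInfty) {a b : ℝ} (ha : 0 ≤ a)
    (hb : 0 ≤ b) :
    ‖diffSum 0 β t (a ^ 2) f - diffSum 0 β t (b ^ 2) f‖ ≤ 2 * (‖f‖ / √t) * |a - b| := by
  have hd : ∀ r ∈ Ici (0 : ℝ), HasDerivWithinAt (fun r => diffSum 0 β t (r ^ 2) f)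
      ((2 * r) • t⁻¹ • diffSum 1 β t (r ^ 2) f) (Ici 0) r := by
    intro r _
    have h1 : HasDerivAt (fun r : ℝ => r ^ 2) (2 * r) r := by simpa using hasDerivAt_pow 2 r
    exact ((hasDerivAt_diffSum_zero β t (r ^ 2) f).scomp r h1).hasDerivWithinAt
  have hbd : ∀ r ∈ Ici (0 : ℝ), ‖(2 * r) • t⁻¹ • diffSum 1 β t (r ^ 2) f‖ ≤ 2 * (‖f‖ / √t) := by
    intro r hr
    have hr' : (0 : ℝ) ≤ r := hr
    have h1 := sqrt_mul_norm_diffSum_one_le β ht (sq_nonneg r) f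
    rw [Real.sqrt_sq hr'] at h1
    rw [norm_smul, Real.norm_of_nonneg (by positivity)]
    linarith
  have := (convex_Ici 0).norm_image_sub_le_of_norm_hasDerivWithin_le hd hbd
    (show b ∈ Ici (0 : ℝ) from hb) (show a ∈ Ici (0 : ℝ) from ha)
  simpa using this

/-- Duhamel's formula for `u = P_t u - ∫₀ᵗ P_s(Au) ds`, applied to the increments between `a²` and
`b²`. The Lipschitz constants of the integrand blow up like `s^{-1/2}`; the substitution `s = r²`
makes the derivative bounded, so the mean value inequality suffices. -/
lemma lipschitz_sq_core {β t : ℝ} (hβ : 0 ≤ β) (ht : 0 < t) {a b : ℝ} (ha : 0 ≤ a) (hb : 0 ≤ b)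
    {p : CZeroInfty × CZeroInfty} (hp : p ∈ coreGraph β) :
    ‖onReal p.1 (a ^ 2) - onReal p.1 (b ^ 2)‖
      ≤ 2 * (‖p.1‖ / √t + 2 * √t * ‖p.2‖) * |a - b| := by
  set φ : ℝ → ℂ := fun s => diffSum 0 β s (a ^ 2) p.1 - diffSum 0 β s (b ^ 2) p.1 with hφ
  have hd : ∀ r ∈ Ioc 0 √t, HasDerivWithinAt (fun r => φ (r ^ 2))
      ((2 * r) • (diffSum 0 β (r ^ 2) (a ^ 2) p.2 - diffSum 0 β (r ^ 2) (b ^ 2) p.2))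
      (Ioc 0 √t) r := by
    intro r hr
    have h1 : HasDerivAt (fun r : ℝ => r ^ 2) (2 * r) r := by simpa using hasDerivAt_pow 2 r
    have h2 : 0 < r ^ 2 := by have := hr.1; positivity
    have h3 : HasDerivAt φ _ (r ^ 2) :=
      (hasDerivAt_diffSum_time hβ h2 (sq_nonneg a) p hp).sub
        (hasDerivAt_diffSum_time hβ h2 (sq_nonneg b) p hp)
    exact (HasDerivAt.scomp_of_eq r h3 h1 rfl).hasDerivWithinAt
  have hbd : ∀ r ∈ Ioc 0 √t,
      ‖(2 * r) • (diffSum 0 β (r ^ 2) (a ^ 2) p.2 - diffSum 0 β (r ^ 2) (b ^ 2) p.2)‖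
        ≤ 4 * ‖p.2‖ * |a - b| := by
    intro r hr
    have hr0 := hr.1
    have h1 := lipschitz_diffSum_sq β (sq_pos_of_pos hr0) p.2 ha hb
    rw [Real.sqrt_sq hr0.le] at h1
    rw [norm_smul, Real.norm_of_nonneg (by positivity)]
    calc _ ≤ 2 * r * (2 * (‖p.2‖ / r) * |a - b|) := by gcongr
      _ = _ := by field_simp; ring
  have hst : 0 < √t := Real.sqrt_pos.2 ht
  have hmv : ∀ r ∈ Ioc 0 √t, ‖φ t - φ (r ^ 2)‖ ≤ 4 * ‖p.2‖ * |a - b| * √t := by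
    intro r hr
    have := (convex_Ioc 0 √t).norm_image_sub_le_of_norm_hasDerivWithin_le hd hbd hr
        (show √t ∈ Ioc 0 √t from ⟨hst, le_rfl⟩)
    simp only [Real.sq_sqrt ht.le] at this
    refine this.trans ?_
    gcongr
    rw [Real.norm_of_nonneg (by linarith [hr.2])]; linarith [hr.1]
  have hlim : Tendsto (fun r => φ (r ^ 2)) (𝓝[>] 0)
      (𝓝 (onReal p.1 (a ^ 2) - onReal p.1 (b ^ 2))) := by
    have h1 : Tendsto (fun r : ℝ => r ^ 2) (𝓝[>] 0) (𝓝[>] 0) := by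
      refine tendsto_nhdsWithin_iff.2 ⟨?_, ?_⟩
      · exact ((continuous_pow 2).tendsto' 0 0 (by norm_num)).mono_left nhdsWithin_le_nhds
      · filter_upwards [self_mem_nhdsWithin] with r hr
        exact pow_pos (show (0 : ℝ) < r from hr) 2
    exact ((tendsto_diffSum_zero hβ (sq_nonneg a) p hp).sub
      (tendsto_diffSum_zero hβ (sq_nonneg b) p hp)).comp h1
  have h2 : ‖φ t - (onReal p.1 (a ^ 2) - onReal p.1 (b ^ 2))‖ ≤ 4 * ‖p.2‖ * |a - b| * √t := by
    refine le_of_tendsto (hlim.const_sub (φ t)).norm ?_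
    filter_upwards [Ioc_mem_nhdsGT hst] with s hs' using hmv s hs'
  have h3 : ‖φ t‖ ≤ 2 * (‖p.1‖ / √t) * |a - b| := lipschitz_diffSum_sq β ht p.1 ha hb
  have h4 := norm_sub_norm_le (onReal p.1 (a ^ 2) - onReal p.1 (b ^ 2)) (φ t)
  rw [norm_sub_rev _ (φ t)] at h4
  linarith

/-- Increments, unlike derivatives, depend continuously on the pair, so the bound survives the
closure. -/
lemma lipschitz_sq {β t : ℝ} (hβ : 0 ≤ β) (ht : 0 < t) {a b : ℝ} (ha : 0 ≤ a) (hb : 0 ≤ b) :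
    ∀ p ∈ closedGraph β, ‖onReal p.1 (a ^ 2) - onReal p.1 (b ^ 2)‖
      ≤ 2 * (‖p.1‖ / √t + 2 * √t * ‖p.2‖) * |a - b| :=
  closedGraph_le (S := {p | ‖onReal p.1 (a ^ 2) - onReal p.1 (b ^ 2)‖
      ≤ 2 * (‖p.1‖ / √t + 2 * √t * ‖p.2‖) * |a - b|})
    (isClosed_le (by fun_prop) (by fun_prop)) fun _ hp => lipschitz_sq_core hβ ht ha hb hp

lemma sqrt_mul_norm_deriv_le {β t : ℝ} (hβ : 0 ≤ β) (ht : 0 < t) {p : CZeroInfty × CZeroInfty}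
    (hp : p ∈ closedGraph β) {x : ℝ} (hx : 0 < x) {d : ℂ} (hd : HasDerivAt (onReal p.1) d x) :
    √x * ‖d‖ ≤ ‖p.1‖ / √t + 2 * √t * ‖p.2‖ := by
  have hsx : 0 < √x := Real.sqrt_pos.2 hx
  have h1 : HasDerivAt (fun r : ℝ => r ^ 2) (2 * √x) √x := by simpa using hasDerivAt_pow 2 √x
  have h2 : HasDerivAt (onReal p.1) d (√x ^ 2) := by rwa [Real.sq_sqrt hx.le]
  have h3 := (HasDerivAt.scomp_of_eq √x h2 h1 rfl).le_of_lip'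
    (C := 2 * (‖p.1‖ / √t + 2 * √t * ‖p.2‖)) (by positivity) (by
      filter_upwards [lt_mem_nhds hsx] with a ha
      exact lipschitz_sq hβ ht ha.le hsx.le p hp)
  rw [norm_smul, Real.norm_of_nonneg (by positivity)] at h3
  linarith

/-! ### Density of the range -/

lemma powExp_pow (n : ℕ) : powExp 0 1 ^ (n + 1) = powExp 0 (n + 1) := by
  refine ext_onReal fun x hx => ?_
  have : onReal (powExp 0 1 ^ (n + 1)) x = onReal (powExp 0 1) x ^ (n + 1) := rfl
  rw [this, onReal_powExp 0 one_pos hx.le, onReal_powExp 0 (by positivity) hx.le,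
    ← Complex.ofReal_pow, pow_zero, one_mul, one_mul, ← Real.exp_nat_mul]
  congr 2; push_cast; ring_nf

lemma star_powExp : star (powExp 0 1) = powExp 0 1 := by
  refine ext_onReal fun x hx => ?_
  have : onReal (star (powExp 0 1)) x = star (onReal (powExp 0 1) x) := rfl
  rw [this, onReal_powExp 0 one_pos hx.le]
  exact Complex.conj_ofReal _

lemma powExp_injective : Function.Injective (powExp 0 1) := by
  have hne : ∀ p : ℝ≥0∞, p ≠ ⊤ → powExp 0 1 p = (Real.exp (-p.toReal) : ℂ) := fun p hp => by
    rw [← onReal_toReal _ hp, onReal_powExp 0 one_pos ENNReal.toReal_nonneg]; simp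
  have h0 : ∀ p : ℝ≥0∞, p ≠ ⊤ → powExp 0 1 p ≠ 0 := fun p hp => by
    rw [hne p hp]; exact_mod_cast (Real.exp_pos _).ne'
  intro p q h
  by_cases hp : p = ⊤ <;> by_cases hq : q = ⊤
  · rw [hp, hq]
  · rw [hp, powExp_top 0 one_pos] at h; exact absurd h.symm (h0 q hq)
  · rw [hq, powExp_top 0 one_pos] at h; exact absurd h (h0 p hp)
  · rw [hne p hp, hne q hq, Complex.ofReal_inj, Real.exp_eq_exp, neg_inj] at h
    exact (ENNReal.toReal_eq_toReal_iff' hp hq).1 h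

/-- A continuous functional vanishing on the constants and on the exponentials is zero. -/
lemma functional_eq_zero {φ : CZeroInfty →L[ℂ] ℂ} (h1 : φ 1 = 0)
    (he : ∀ ξ > 0, φ (powExp 0 ξ) = 0) : φ = 0 := by
  set A : StarSubalgebra ℂ CZeroInfty := StarAlgebra.adjoin ℂ {powExp 0 1} with hA
  have hmem : powExp 0 1 ∈ A := StarAlgebra.subset_adjoin ℂ _ rfl
  have hsep : A.SeparatesPoints := fun p q hpq =>
    ⟨powExp 0 1, ⟨powExp 0 1, hmem, rfl⟩, fun h => hpq (powExp_injective h)⟩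
  -- Stone–Weierstrass: `exp(-x)`, with value `0` at infinity, separates the points of `[0,∞]`. It
  -- is self-adjoint, so the star algebra consists of polynomials in it.
  have hdense := ContinuousMap.starSubalgebra_topologicalClosure_eq_top_of_separatesPoints A hsep
  have hzero : ∀ a ∈ A, φ a = 0 := by
    intro a ha
    rw [hA, ← StarSubalgebra.mem_toSubalgebra, StarAlgebra.adjoin_toSubalgebra, Set.star_singleton,
      star_powExp, Set.union_self, Algebra.adjoin_singleton_eq_range_aeval] at ha
    obtain ⟨P, rfl⟩ := ha
    change φ (Polynomial.aeval (powExp 0 1) P) = 0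
    rw [Polynomial.aeval_eq_sum_range, map_sum]
    refine Finset.sum_eq_zero fun n _ => ?_
    rw [map_smul]
    rcases n with _ | n
    · rw [pow_zero, h1, smul_zero]
    · rw [powExp_pow, he _ (by positivity), smul_zero]
  ext f
  have hf : f ∈ A.topologicalClosure := by rw [hdense]; trivial
  have hcl : closure (A : Set CZeroInfty) ⊆ {f | φ f = 0} :=
    closure_minimal hzero (isClosed_eq φ.continuous continuous_const)
  exact hcl hf

/-- For `Re l > 0`, the range of `l - A` on the core is dense. -/
lemma functional_eq_zero_of_range {β : ℝ} {l : ℂ} (hl : 0 < l.re)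
    {φ : CZeroInfty →L[ℂ] ℂ} (h : ∀ p ∈ coreGraph β, φ (l • p.1 - p.2) = 0) : φ = 0 := by
  have hl0 : l ≠ 0 := fun h => by simp [h] at hl
  refine functional_eq_zero ?_ ?_
  · have := h (1, 0) (Submodule.subset_span (Or.inl rfl))
    simpa [hl0] using this
  set F : ℝ → ℂ := fun ξ => φ (powExp 0 ξ) with hF
  have hFd : ∀ ξ, 0 < ξ → HasDerivAt F (-φ (powExp 1 ξ)) ξ := by
    intro ξ hξ
    have := (φ.restrictScalars ℝ).hasFDerivAt.comp_hasDerivAt ξ (hasDerivAt_powExp hξ)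
    rwa [map_neg] at this
  have heq : ∀ ξ : ℝ, 0 < ξ → l * F ξ - ξ ^ 2 * φ (powExp 1 ξ) + β * ξ * F ξ = 0 := by
    intro ξ hξ
    have := h (powExp 0 ξ, genExp β ξ) (Submodule.subset_span (Or.inr ⟨ξ, hξ, rfl⟩))
    rw [genExp, map_sub, map_sub, map_smul, map_smul, map_smul] at this
    simp only [smul_eq_mul, Complex.ofReal_mul, Complex.ofReal_pow] at this
    linear_combination this
  -- The equation is `ξ²F' + (l + βξ)F = 0`, with integrating factor `ξ^β e^{-l/ξ}`. Thus `G` is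
  -- constant, and it tends to `0` as `ξ → 0+` because `F` is bounded and `Re l > 0`.
  set G : ℝ → ℂ := fun ξ => ((ξ ^ β : ℝ) : ℂ) * Complex.exp (-(l * ((ξ⁻¹ : ℝ) : ℂ))) * F ξ with hG
  have hGd : ∀ ξ ∈ Ioi (0 : ℝ), HasDerivAt G 0 ξ := by
    intro ξ hξ
    have hξ0 : (0 : ℝ) < ξ := hξ
    have h1 := (Real.hasDerivAt_rpow_const (x := ξ) (p := β) (Or.inl hξ0.ne')).ofReal_comp
    have h2 : HasDerivAt (fun ξ : ℝ => Complex.exp (-(l * ((ξ⁻¹ : ℝ) : ℂ)))) _ ξ :=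
      (((hasDerivAt_inv hξ0.ne').ofReal_comp.const_mul l).neg).cexp
    refine ((h1.mul h2).mul (hFd ξ hξ0)).congr_deriv ?_
    have hξc : (ξ : ℂ) ≠ 0 := by exact_mod_cast hξ0.ne'
    rw [Real.rpow_sub_one hξ0.ne']
    simp only [Pi.mul_apply, Pi.neg_apply]
    push_cast
    have h3 := heq ξ hξ0
    set E := Complex.exp (-(l * (ξ : ℂ)⁻¹))
    have h4 : φ (powExp 1 ξ) = (l * F ξ + β * ξ * F ξ) / ξ ^ 2 := by
      rw [eq_div_iff (by positivity)]; linear_combination -h3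
    rw [h4]
    field_simp
    ring_nf
  have hconst : ∀ ξ ∈ Ioi (0 : ℝ), ∀ η ∈ Ioi (0 : ℝ), G ξ = G η := by
    intro ξ hξ η hη
    refine (convex_Ioi (0 : ℝ)).is_const_of_fderivWithin_eq_zero (𝕜 := ℝ) (f := G)
      (fun z hz => (hGd z hz).differentiableAt.differentiableWithinAt) (fun z hz => ?_) hξ hη
    rw [fderivWithin_of_isOpen isOpen_Ioi hz]
    ext
    simp [(hGd z hz).deriv]
  have hbound : ∀ ξ ∈ Ioi (0 : ℝ), ‖G ξ‖ ≤ ξ ^ β * Real.exp (-(l.re * ξ⁻¹)) * ‖φ‖ := by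
    intro ξ hξ
    have hξ0 : (0 : ℝ) < ξ := hξ
    have hr := Real.rpow_nonneg hξ0.le β
    rw [hG]
    simp only [norm_mul]
    rw [Complex.norm_exp, Complex.norm_real, Real.norm_of_nonneg hr]
    have e : (-(l * ((ξ⁻¹ : ℝ) : ℂ))).re = -(l.re * ξ⁻¹) := by simp
    rw [e]
    refine mul_le_mul_of_nonneg_left ?_ (by positivity)
    exact (φ.le_opNorm _).trans (mul_le_of_le_one_right (norm_nonneg _) (norm_powExp_zero_le hξ0))
  have hlim : Tendsto (fun ξ : ℝ => ξ ^ β * Real.exp (-(l.re * ξ⁻¹)) * ‖φ‖) (𝓝[>] 0) (𝓝 0) := by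
    have h1 := (tendsto_rpow_mul_exp_neg_mul_atTop_nhds_zero (-β) l.re hl).comp
      (tendsto_inv_nhdsGT_zero (𝕜 := ℝ))
    have h2 := h1.mul_const ‖φ‖
    rw [zero_mul] at h2
    refine h2.congr' ?_
    filter_upwards [self_mem_nhdsWithin] with ξ hξ
    have hξ0 : (0 : ℝ) < ξ := hξ
    simp only [Function.comp]
    rw [Real.inv_rpow hξ0.le, Real.rpow_neg hξ0.le, inv_inv, neg_mul]
  intro ξ hξ
  have hG0 : G ξ = 0 := by
    have h1 : Tendsto (fun _ : ℝ => ‖G ξ‖) (𝓝[>] 0) (𝓝 0) := by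
      refine squeeze_zero' (Eventually.of_forall fun _ => norm_nonneg _) ?_ hlim
      filter_upwards [self_mem_nhdsWithin] with η hη
      rw [hconst ξ hξ η hη]; exact hbound η hη
    exact norm_eq_zero.1 (tendsto_nhds_unique tendsto_const_nhds h1)
  have h3 : ((ξ ^ β : ℝ) : ℂ) ≠ 0 := by exact_mod_cast (Real.rpow_pos_of_pos hξ β).ne'
  rcases mul_eq_zero.1 hG0 with h4 | h4
  · rcases mul_eq_zero.1 h4 with h5 | h5
    · exact absurd h5 h3
    · exact absurd h5 (Complex.exp_ne_zero _)
  · exact h4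

/-- Hahn–Banach in the quotient by the closure of `W`: a norming functional there pulls back to one
vanishing on `W`. -/
lemma dense_of_functional {E : Type*} [NormedAddCommGroup E] [NormedSpace ℂ E] (W : Submodule ℂ E)
    (h : ∀ φ : E →L[ℂ] ℂ, (∀ w ∈ W, φ w = 0) → φ = 0) (x : E) : x ∈ closure (W : Set E) := by
  by_contra hx
  have hcl : IsClosed (W.topologicalClosure : Set E) := W.isClosed_topologicalClosure
  have hx' : (W.topologicalClosure.mkQ x) ≠ 0 := by
    rw [Submodule.mkQ_apply, Ne, Submodule.Quotient.mk_eq_zero]; exact hx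
  obtain ⟨g, -, hg⟩ := exists_dual_vector ℂ (W.topologicalClosure.mkQ x) (norm_ne_zero_iff.2 hx')
  have h0 : g.comp W.topologicalClosure.mkQL = 0 := by
    refine h _ fun w hw => ?_
    have : W.topologicalClosure.mkQ w = 0 := by
      rw [Submodule.mkQ_apply, Submodule.Quotient.mk_eq_zero]
      exact W.le_topologicalClosure hw
    exact (congr_arg g this).trans (map_zero g)
  have h1 : g (W.topologicalClosure.mkQ x) = 0 := DFunLike.congr_fun h0 x
  rw [hg] at h1
  exact hx' (norm_eq_zero.1 (Complex.ofReal_eq_zero.1 h1))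

/-! ### Invertibility of `l - A` on the closed graph -/

/-- The map `(u, v) ↦ l u - v` on the closed graph. -/
noncomputable def resolventMap (β : ℝ) (l : ℂ) : closedGraph β →L[ℂ] CZeroInfty :=
  (l • ContinuousLinearMap.fst ℂ CZeroInfty CZeroInfty
    - ContinuousLinearMap.snd ℂ CZeroInfty CZeroInfty).comp (closedGraph β).subtypeL

lemma resolventMap_apply (β : ℝ) (l : ℂ) (p : closedGraph β) :
    resolventMap β l p = l • p.1.1 - p.1.2 := rfl

lemma antilipschitz_resolventMap {β M : ℝ} (hβ : 0 ≤ β) (hM : 2 + 2 * β ≤ M) {l : ℂ} (hl : l ≠ 0)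
    (hs : -(‖l‖ / (8 * M)) ≤ l.re) : ∃ K, AntilipschitzWith K (resolventMap β l) := by
  have hl0 : 0 < ‖l‖ := norm_pos_iff.2 hl
  have hM0 : 0 < M := by linarith
  refine ⟨⟨(4 + 16 * M) / ‖l‖ + (5 + 16 * M), by positivity⟩,
    AddMonoidHomClass.antilipschitz_of_bound _ fun p => ?_⟩
  have h1 := resolvent_estimate hβ hM hl hs p.1 p.2
  rw [← resolventMap_apply β l p] at h1
  set f := resolventMap β l p with hf
  have h2 : p.1.2 = l • p.1.1 - f := by rw [hf, resolventMap_apply]; abel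
  have h3 : ‖p.1.2‖ ≤ (5 + 16 * M) * ‖f‖ := by
    rw [h2]
    refine (norm_sub_le _ _).trans ?_
    rw [norm_smul]; linarith
  have h4 : ‖p.1.1‖ ≤ (4 + 16 * M) / ‖l‖ * ‖f‖ := by
    rw [div_mul_eq_mul_div, le_div_iff₀ hl0]; linarith
  have h5 : 0 ≤ (4 + 16 * M) / ‖l‖ * ‖f‖ := by positivity
  have h6 : 0 ≤ (5 + 16 * M) * ‖f‖ := by positivity
  change ‖p.1‖ ≤ ((4 + 16 * M) / ‖l‖ + (5 + 16 * M)) * ‖f‖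
  rw [Prod.norm_def, add_mul]
  exact max_le (by linarith) (by linarith)

/-- The antilipschitz bound gives injectivity and, by completeness of the graph, a closed range; the
range is also dense. -/
lemma bijective_resolventMap_of_re_pos {β M : ℝ} (hβ : 0 ≤ β) (hM : 2 + 2 * β ≤ M) {l : ℂ}
    (hl : 0 < l.re) : Function.Bijective (resolventMap β l) := by
  have hl0 : l ≠ 0 := fun h => by simp [h] at hl
  have hM0 : 0 < M := by linarith
  have hs : -(‖l‖ / (8 * M)) ≤ l.re := by
    have : 0 ≤ ‖l‖ / (8 * M) := by positivity
    linarith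
  obtain ⟨K, hK⟩ := antilipschitz_resolventMap hβ hM hl0 hs
  refine ⟨hK.injective, fun f => ?_⟩
  have : CompleteSpace (closedGraph β) := (isClosed_closedGraph β).completeSpace_coe
  have hcl : IsClosed (range (resolventMap β l)) :=
    hK.isClosed_range (resolventMap β l).uniformContinuous
  have hd := dense_of_functional (LinearMap.range (resolventMap β l).toLinearMap) (fun φ hφ =>
    functional_eq_zero_of_range hl fun p hp =>
      hφ _ ⟨⟨p, coreGraph_le_closedGraph β hp⟩, rfl⟩) f
  have : (LinearMap.range (resolventMap β l).toLinearMap : Set CZeroInfty)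
      = range (resolventMap β l) := rfl
  rw [this, hcl.closure_eq] at hd
  exact hd

lemma bijective_resolventMap {β M : ℝ} (hβ : 0 ≤ β) (hM : 2 + 2 * β ≤ M) {l : ℂ} (hl : l ≠ 0)
    (hs : -(‖l‖ / (8 * (4 + 16 * M))) < l.re) : Function.Bijective (resolventMap β l) := by
  have hM0 : 0 < M := by linarith
  have hl0 : 0 < ‖l‖ := norm_pos_iff.2 hl
  have hM2 : 2 ≤ M := by linarith
  set K := 4 + 16 * M with hK
  have hK0 : 0 < K := by positivity
  have hs1 : -(‖l‖ / (8 * M)) ≤ l.re := by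
    refine le_trans ?_ hs.le
    rw [neg_le_neg_iff]
    gcongr
    linarith
  obtain ⟨_, hanti⟩ := antilipschitz_resolventMap hβ hM hl hs1
  refine ⟨hanti.injective, fun f => ?_⟩
  -- Large enough to push `l + δ` into the right half plane, and small enough that `|l + δ| ≥ |l|/2`
  -- and `δ‖R(l + δ)‖ ≤ 1/2`. Then `1 - δR(l + δ)` is inverted by a Neumann series.
  set δ : ℝ := ‖l‖ / (4 * K) with hδ
  have hδ0 : 0 < δ := by positivity
  set l' : ℂ := l + δ with hl'
  have hre : 0 < l'.re := by
    have : ‖l‖ / (8 * K) ≤ δ := by rw [hδ]; gcongr; linarith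
    simp only [hl', Complex.add_re, Complex.ofReal_re]
    linarith
  have hδl : δ ≤ ‖l‖ / 2 := by
    rw [hδ]; gcongr; linarith
  have hnl' : ‖l‖ / 2 ≤ ‖l'‖ := by
    have := norm_sub_norm_le l (-(δ : ℂ))
    rw [norm_neg, Complex.norm_real, Real.norm_of_nonneg hδ0.le, sub_neg_eq_add] at this
    linarith
  have hl'0 : 0 < ‖l'‖ := by linarith
  have hbij := bijective_resolventMap_of_re_pos hβ hM hre
  have : CompleteSpace (closedGraph β) := (isClosed_closedGraph β).completeSpace_coe
  let e : closedGraph β ≃L[ℂ] CZeroInfty := ContinuousLinearEquiv.ofBijective (resolventMap β l')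
    (LinearMap.ker_eq_bot.2 hbij.1) (LinearMap.range_eq_top.2 hbij.2)
  have he : ∀ p, e p = resolventMap β l' p := fun p => rfl
  let N : CZeroInfty →L[ℂ] CZeroInfty := (δ : ℂ) • ((ContinuousLinearMap.fst ℂ _ _).comp
    ((closedGraph β).subtypeL.comp e.symm.toContinuousLinearMap))
  have hNapp : ∀ g, N g = (δ : ℂ) • (e.symm g).1.1 := fun g => rfl
  have hN : ‖N‖ < 1 := by
    refine lt_of_le_of_lt (N.opNorm_le_bound (M := 1 / 2) (by norm_num) fun g => ?_)
      (by norm_num : (1 / 2 : ℝ) < 1)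
    have hs' : -(‖l'‖ / (8 * M)) ≤ l'.re := by
      have : 0 ≤ ‖l'‖ / (8 * M) := by positivity
      linarith
    have h1 := resolvent_estimate hβ hM (norm_pos_iff.1 hl'0) hs' (e.symm g).1 (e.symm g).2
    rw [← resolventMap_apply, ← he, e.apply_symm_apply] at h1
    rw [hNapp, norm_smul, Complex.norm_real, Real.norm_of_nonneg hδ0.le]
    have h2 : ‖l‖ / 2 * ‖(e.symm g).1.1‖ ≤ K * ‖g‖ :=
      (mul_le_mul_of_nonneg_right hnl' (norm_nonneg _)).trans h1
    have h3 : δ * ‖(e.symm g).1.1‖ = (‖l‖ / 2 * ‖(e.symm g).1.1‖) / (2 * K) := by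
      rw [hδ]; field_simp; ring
    rw [h3, div_le_iff₀ (by positivity)]
    linarith
  obtain ⟨U, hU⟩ := isUnit_one_sub_of_norm_lt_one (R := CZeroInfty →L[ℂ] CZeroInfty) hN
  set g := (↑U⁻¹ : CZeroInfty →L[ℂ] CZeroInfty) f with hg
  have h4 : g - N g = f := by
    have h5 : (↑U * ↑U⁻¹ : CZeroInfty →L[ℂ] CZeroInfty) f = f := by simp
    rw [hU] at h5
    exact h5
  refine ⟨e.symm g, ?_⟩
  have h6 : resolventMap β l' (e.symm g) = g := by rw [← he, e.apply_symm_apply]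
  rw [resolventMap_apply] at h6 ⊢
  rw [← h4, hNapp]
  nth_rw 3 [← h6]
  rw [hl', add_smul]
  abel

lemma exists_resolvent_closedGraph {β M : ℝ} (hβ : 0 ≤ β) (hM : 2 + 2 * β ≤ M) {l : ℂ}
    (hl : l ≠ 0) (hs : -(‖l‖ / (8 * (4 + 16 * M))) < l.re) :
    ∃ R : CZeroInfty →L[ℂ] CZeroInfty, (∀ f, (R f, l • R f - f) ∈ closedGraph β) ∧
      ∀ p ∈ closedGraph β, R (l • p.1 - p.2) = p.1 := by
  have hbij := bijective_resolventMap hβ hM hl hs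
  have : CompleteSpace (closedGraph β) := (isClosed_closedGraph β).completeSpace_coe
  let e : closedGraph β ≃L[ℂ] CZeroInfty := ContinuousLinearEquiv.ofBijective (resolventMap β l)
    (LinearMap.ker_eq_bot.2 hbij.1) (LinearMap.range_eq_top.2 hbij.2)
  have he : ∀ p, e p = l • p.1.1 - p.1.2 := fun p => rfl
  refine ⟨(ContinuousLinearMap.fst ℂ _ _).comp
    ((closedGraph β).subtypeL.comp e.symm.toContinuousLinearMap), fun f => ?_, fun p hp => ?_⟩
  · change ((e.symm f).1.1, l • (e.symm f).1.1 - f) ∈ closedGraph β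
    have h1 : l • (e.symm f).1.1 - f = (e.symm f).1.2 := by
      nth_rw 2 [← e.apply_symm_apply f]
      rw [he]; abel
    rw [h1]
    exact (e.symm f).2
  · change (e.symm (l • p.1 - p.2)).1.1 = p.1
    rw [← he ⟨p, hp⟩, e.symm_apply_apply]

/-! ### Regularity of the elements of the closed graph -/

lemma IsSmoothPair.sub {β : ℝ} {U U₁ U₂ V V₁ V₂ : ℝ → ℂ} {p q : CZeroInfty × CZeroInfty}
    (hU : IsSmoothPair β U U₁ U₂ p) (hV : IsSmoothPair β V V₁ V₂ q) :
    IsSmoothPair β (U - V) (U₁ - V₁) (U₂ - V₂) (p - q) where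
  hasDerivAt x := (hU.1 x).sub (hV.1 x)
  hasDerivAt' x := (hU.2 x).sub (hV.2 x)
  eq_fst x hx := congr_arg₂ (· - ·) (hU.3 x hx) (hV.3 x hx)
  eq_snd x hx := by
    refine (congr_arg₂ (· - ·) (hU.4 x hx) (hV.4 x hx)).trans ?_
    simp only [Pi.sub_apply]; ring
  top := by simp [hU.5, hV.5]

lemma IsSmoothPair.hasDerivAt_onReal {β : ℝ} {U U₁ U₂ : ℝ → ℂ} {p : CZeroInfty × CZeroInfty}
    (hU : IsSmoothPair β U U₁ U₂ p) {x : ℝ} (hx : 0 < x) : HasDerivAt (onReal p.1) (U₁ x) x := by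
  refine (hU.1 x).congr_of_eventuallyEq ?_
  filter_upwards [lt_mem_nhds hx] with y hy using hU.3 y hy.le

/-- `β U' (x)` is an average of `v` over `[0, x]`. -/
lemma IsSmoothPair.norm_deriv_le {β : ℝ} (hβ : 0 < β) {U U₁ U₂ : ℝ → ℂ}
    {p : CZeroInfty × CZeroInfty} (hU : IsSmoothPair β U U₁ U₂ p) {x : ℝ} (hx : 0 ≤ x) :
    ‖U₁ x‖ ≤ ‖p.2‖ / β := by
  have hβ1 : -1 < β - 1 := by linarith
  have hint : IntervalIntegrable (fun σ : ℝ => σ ^ (β - 1)) volume 0 1 :=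
    intervalIntegral.intervalIntegrable_rpow' hβ1
  have hU₁ : Continuous U₁ := continuous_iff_continuousAt.2 fun y => (hU.2 y).continuousAt
  -- By `v = xU'' + βU'`, the derivative of `σ^β U'(σx)` in `σ` is `σ^{β-1} v(σx)`, integrable at
  -- `0` since `β > 0`.
  have h := intervalIntegral.integral_eq_sub_of_hasDerivAt_of_le (zero_le_one' ℝ)
    (f := fun σ : ℝ => σ ^ β • U₁ (σ * x))
    (f' := fun σ : ℝ => σ ^ (β - 1) • onReal p.2 (σ * x))
    (by
      refine ContinuousOn.smul (f := fun σ : ℝ => σ ^ β) ?_ (hU₁.comp (continuous_mul_const x)).continuousOn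
      exact (Real.continuous_rpow_const hβ.le).continuousOn)
    (fun σ hσ => by
      have hσ0 : 0 < σ := hσ.1
      have h1 := Real.hasDerivAt_rpow_const (x := σ) (p := β) (Or.inl hσ0.ne')
      have h2 : HasDerivAt (fun σ : ℝ => σ * x) x σ := by
        simpa using (hasDerivAt_id σ).mul_const x
      have h3 : HasDerivAt (fun σ : ℝ => U₁ (σ * x)) _ σ :=
        HasDerivAt.scomp_of_eq σ (hU.2 (σ * x)) h2 rfl
      refine (h1.smul h3).congr_deriv ?_
      rw [hU.4 _ (by positivity)]
      have h4 : σ ^ β = σ ^ (β - 1) * σ := by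
        rw [← Real.rpow_add_one hσ0.ne']; congr 1; ring
      rw [h4]
      simp only [Complex.real_smul]
      push_cast; ring)
    (hint.smul_continuousOn
      ((continuous_onReal p.2).comp (continuous_mul_const x)).continuousOn)
  simp only [Real.one_rpow, one_smul, one_mul, Real.zero_rpow hβ.ne', zero_smul, sub_zero] at h
  rw [← h]
  refine (intervalIntegral.norm_integral_le_of_norm_le zero_le_one
    (g := fun σ : ℝ => σ ^ (β - 1) * ‖p.2‖) (ae_of_all _ fun σ hσ => ?_)
    (hint.mul_const _)).trans (le_of_eq ?_)
  · have : 0 ≤ σ ^ (β - 1) := Real.rpow_nonneg hσ.1.le _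
    rw [norm_smul, Real.norm_of_nonneg this]
    exact mul_le_mul_of_nonneg_left (norm_onReal_le _ _) this
  · rw [intervalIntegral.integral_mul_const, integral_rpow (Or.inl hβ1)]
    simp [hβ.ne']
    field_simp

lemma tendstoUniformlyOn_of_dist_le {E : Type*} [PseudoMetricSpace E] {q : ℕ → E} {q₀ : E}
    (hq : Tendsto q atTop (𝓝 q₀)) {F : ℕ → ℝ → ℂ} {f : ℝ → ℂ} {s : Set ℝ} {C : ℝ}
    (h : ∀ n, ∀ x ∈ s, dist (F n x) (f x) ≤ C * dist (q n) q₀) :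
    TendstoUniformlyOn F f atTop s := by
  rw [Metric.tendstoUniformlyOn_iff]
  intro ε hε
  have h1 := ((tendsto_iff_dist_tendsto_zero.1 hq).const_mul C)
  rw [mul_zero] at h1
  filter_upwards [h1.eventually (gt_mem_nhds hε)] with n hn x hx
  rw [dist_comm]
  exact (h n x hx).trans_lt hn

lemma cauchySeq_of_dist_le {E : Type*} [PseudoMetricSpace E] {q : ℕ → E} (hq : CauchySeq q)
    {a : ℕ → ℂ} {C : ℝ} (hC : 0 ≤ C) (h : ∀ n m, dist (a n) (a m) ≤ C * dist (q n) (q m)) :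
    CauchySeq a := by
  rw [Metric.cauchySeq_iff] at hq ⊢
  intro ε hε
  obtain ⟨N, hN⟩ := hq (ε / (C + 1)) (by positivity)
  refine ⟨N, fun m hm n hn => (h m n).trans_lt ?_⟩
  have h1 := hN m hm n hn
  rw [lt_div_iff₀ (by positivity)] at h1
  nlinarith [dist_nonneg (x := q m) (y := q n)]

/-- Along a core sequence the gradient bound makes `√x U'` Cauchy uniformly on `x > 0`, and the
equation then gives local uniform convergence of `U''`. For `β > 0` the averaging bound makes `U'`
converge uniformly up to `0`. -/
lemma closedGraph_structure {β : ℝ} (hβ : 0 ≤ β) {p : CZeroInfty × CZeroInfty}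
    (hp : p ∈ closedGraph β) : ∃ w : ℝ → ℂ,
      (∀ x, 0 < x → HasDerivAt (onReal p.1) (w x) x) ∧
      (∀ x, 0 < x → HasDerivAt w ((onReal p.2 x - β * w x) / x) x) ∧
      Tendsto (fun x : ℝ => (√x : ℂ) * w x) (𝓝[>] 0) (𝓝 0) ∧
      (0 < β → ContinuousWithinAt w (Ici 0) 0 ∧ onReal p.2 0 = β * w 0) := by
  obtain ⟨q, hqm, hq⟩ := mem_closure_iff_seq_limit.1 hp
  have hqm' : ∀ n, q n ∈ coreGraph β := hqm
  choose U U₁ U₂ hU using fun n => exists_isSmoothPair (q n) (hqm' n)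
  -- The gradient inequality at `t = 1`; both components are bounded by the product norm, whence `3
  -- = 1 + 2`.
  have hest : ∀ x, 0 < x → ∀ n m, √x * ‖U₁ n x - U₁ m x‖ ≤ 3 * dist (q n) (q m) := by
    intro x hx n m
    have hmem := coreGraph_le_closedGraph β ((coreGraph β).sub_mem (hqm' n) (hqm' m))
    have h1 := sqrt_mul_norm_deriv_le hβ one_pos hmem hx
      ((hU n).sub (hU m) |>.hasDerivAt_onReal hx)
    rw [Real.sqrt_one] at h1
    have h2 := norm_fst_le (q n - q m)
    have h3 := norm_snd_le (q n - q m)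
    rw [dist_eq_norm]
    refine h1.trans ?_
    linarith
  have hest0 : 0 < β → ∀ x, 0 ≤ x → ∀ n m, dist (U₁ n x) (U₁ m x) ≤ 1 / β * dist (q n) (q m) := by
    intro hβ0 x hx n m
    have h1 := ((hU n).sub (hU m)).norm_deriv_le hβ0 hx
    have h3 := norm_snd_le (q n - q m)
    rw [dist_eq_norm, dist_eq_norm, one_div_mul_eq_div]
    refine h1.trans ?_
    gcongr
  have hestd : ∀ x, 0 < x → ∀ n m, dist (U₁ n x) (U₁ m x) ≤ 3 / √x * dist (q n) (q m) := by
    intro x hx n m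
    have hsx : 0 < √x := Real.sqrt_pos.2 hx
    have := hest x hx n m
    rw [dist_eq_norm, div_mul_eq_mul_div, le_div_iff₀ hsx]
    linarith
  have hcau : ∀ x, 0 < x ∨ (0 < β ∧ 0 ≤ x) → CauchySeq fun n => U₁ n x := by
    rintro x (hx | ⟨hβ0, hx⟩)
    · exact cauchySeq_of_dist_le hq.cauchySeq (by positivity) (hestd x hx)
    · exact cauchySeq_of_dist_le hq.cauchySeq (by positivity) (hest0 hβ0 x hx)
  set w : ℝ → ℂ := fun x => limUnder atTop fun n => U₁ n x with hw
  have hlim : ∀ x, 0 < x ∨ (0 < β ∧ 0 ≤ x) → Tendsto (fun n => U₁ n x) atTop (𝓝 (w x)) :=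
    fun x hx => tendsto_nhds_limUnder (cauchySeq_tendsto_of_complete (hcau x hx))
  have hest' : ∀ x, 0 < x → ∀ n, √x * ‖U₁ n x - w x‖ ≤ 3 * dist (q n) p := by
    intro x hx n
    exact le_of_tendsto_of_tendsto (((hlim x (Or.inl hx)).const_sub (U₁ n x)).norm.const_mul √x)
      ((tendsto_const_nhds.dist hq).const_mul 3) (Eventually.of_forall (hest x hx n))
  have hestd' : ∀ a, 0 < a → ∀ n, ∀ x ∈ Ioi a, dist (U₁ n x) (w x) ≤ 3 / √a * dist (q n) p := by
    intro a ha n x hx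
    have hsa : 0 < √a := Real.sqrt_pos.2 ha
    have h1 := hest' x (ha.trans hx) n
    have h2 : √a ≤ √x := Real.sqrt_le_sqrt (le_of_lt hx)
    rw [dist_eq_norm, div_mul_eq_mul_div, le_div_iff₀ hsa, mul_comm]
    exact (mul_le_mul_of_nonneg_right h2 (norm_nonneg _)).trans h1
  have hest0' : 0 < β → ∀ n, ∀ x ∈ Ici (0 : ℝ), dist (U₁ n x) (w x) ≤ 1 / β * dist (q n) p := by
    intro hβ0 n x hx
    exact le_of_tendsto_of_tendsto (tendsto_const_nhds.dist (hlim x (Or.inr ⟨hβ0, hx⟩)))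
      ((tendsto_const_nhds.dist hq).const_mul _) (Eventually.of_forall (hest0 hβ0 x hx n))
  have hq1 : ∀ x, Tendsto (fun n => onReal (q n).1 x) atTop (𝓝 (onReal p.1 x)) := fun x =>
    ((continuous_onReal_left x).tendsto _).comp ((continuous_fst.tendsto p).comp hq)
  have hq2 : ∀ x, Tendsto (fun n => onReal (q n).2 x) atTop (𝓝 (onReal p.2 x)) := fun x =>
    ((continuous_onReal_left x).tendsto _).comp ((continuous_snd.tendsto p).comp hq)
  refine ⟨w, fun x hx => ?_, fun x hx => ?_, ?_, fun hβ0 => ⟨?_, ?_⟩⟩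
  · have ha : 0 < x / 2 := by positivity
    exact hasDerivAt_of_tendstoUniformlyOn isOpen_Ioi
      (tendstoUniformlyOn_of_dist_le hq (hestd' (x / 2) ha))
      (Eventually.of_forall fun n y hy => (hU n).hasDerivAt_onReal (ha.trans hy))
      (fun y _ => hq1 y) (show x ∈ Ioi (x / 2) by simp only [mem_Ioi]; linarith)
  · have ha : 0 < x / 2 := by positivity
    have hsa : 0 < √(x / 2) := Real.sqrt_pos.2 ha
    have hunif : TendstoUniformlyOn U₂ (fun y => (onReal p.2 y - β * w y) / y) atTop
        (Ioi (x / 2)) := by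
      refine tendstoUniformlyOn_of_dist_le hq (C := (1 + β * (3 / √(x / 2))) / (x / 2)) fun n y hy => ?_
      have hy0 : 0 < y := ha.trans hy
      have hyc : (y : ℂ) ≠ 0 := by exact_mod_cast hy0.ne'
      have e : U₂ n y = (onReal (q n).2 y - β * U₁ n y) / y := by
        rw [(hU n).4 y hy0.le]; field_simp; ring
      have h1 := hestd' (x / 2) ha n y hy
      have h2 : ‖onReal (q n).2 y - onReal p.2 y‖ ≤ dist (q n) p := by
        rw [dist_eq_norm]
        exact (norm_onReal_le ((q n).2 - p.2) y).trans (norm_snd_le (q n - p))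
      rw [dist_eq_norm] at h1
      rw [dist_eq_norm, e, ← sub_div, norm_div, Complex.norm_real, Real.norm_of_nonneg hy0.le,
        div_mul_eq_mul_div]
      refine div_le_div₀ (by positivity) ?_ ha (le_of_lt hy)
      have e2 : onReal (q n).2 y - β * U₁ n y - (onReal p.2 y - β * w y)
          = (onReal (q n).2 y - onReal p.2 y) - β * (U₁ n y - w y) := by ring
      rw [e2]
      refine (norm_sub_le _ _).trans ?_
      rw [norm_mul, Complex.norm_real, Real.norm_of_nonneg hβ, add_mul, one_mul, mul_assoc]
      exact add_le_add h2 (mul_le_mul_of_nonneg_left h1 hβ)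
    exact hasDerivAt_of_tendstoUniformlyOn isOpen_Ioi hunif
      (Eventually.of_forall fun n y _ => (hU n).2 y)
      (fun y hy => hlim y (Or.inl (ha.trans hy)))
      (show x ∈ Ioi (x / 2) by simp only [mem_Ioi]; linarith)
  · rw [Metric.tendsto_nhds]
    intro ε hε
    have h1 := ((tendsto_iff_dist_tendsto_zero.1 hq).const_mul 3)
    rw [mul_zero] at h1
    obtain ⟨n, hn⟩ := (h1.eventually (gt_mem_nhds (half_pos hε))).exists
    have h2 : Tendsto (fun x : ℝ => √x * ‖U₁ n x‖) (𝓝[>] 0) (𝓝 0) := by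
      have h3 : ContinuousAt (fun x : ℝ => √x * ‖U₁ n x‖) 0 :=
        Real.continuous_sqrt.continuousAt.mul ((hU n).2 0).continuousAt.norm
      have h4 := h3.tendsto
      rw [Real.sqrt_zero, zero_mul] at h4
      exact h4.mono_left nhdsWithin_le_nhds
    -- Here `√x U'` vanishes at `0` for the smooth approximant, and the error in `√x w` is uniform
    -- in `x`.
    filter_upwards [h2.eventually (gt_mem_nhds (half_pos hε)), self_mem_nhdsWithin] with x hx hx0
    have h5 := hest' x hx0 n
    have h6 : ‖w x‖ ≤ ‖U₁ n x‖ + ‖U₁ n x - w x‖ := by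
      have := norm_sub_le (U₁ n x) (U₁ n x - w x)
      rwa [sub_sub_cancel] at this
    have h7 := mul_le_mul_of_nonneg_left h6 (Real.sqrt_nonneg x)
    rw [dist_zero_right, norm_mul, Complex.norm_real, Real.norm_of_nonneg (Real.sqrt_nonneg x)]
    linarith
  · refine (tendstoUniformlyOn_of_dist_le hq (hest0' hβ0)).continuousOn
      (Frequently.of_forall fun n => ?_) 0 (mem_Ici.2 le_rfl)
    exact (continuous_iff_continuousAt.2 fun y => ((hU n).2 y).continuousAt).continuousOn
  · refine tendsto_nhds_unique (hq2 0) ?_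
    refine ((hlim 0 (Or.inr ⟨hβ0, le_rfl⟩)).const_mul (β : ℂ)).congr fun n => ?_
    rw [(hU n).4 0 le_rfl]; simp

lemma contDiffOn_one_of_hasDerivAt {f f' : ℝ → ℂ} {s : Set ℝ} (hs : IsOpen s)
    (hf : ∀ x ∈ s, HasDerivAt f (f' x) x) (hc : ContinuousOn f' s) : ContDiffOn ℝ 1 f s := by
  rw [contDiffOn_one_iff_derivWithin hs.uniqueDiffOn]
  refine ⟨fun x hx => (hf x hx).differentiableAt.differentiableWithinAt, hc.congr fun x hx => ?_⟩
  rw [derivWithin_of_isOpen hs hx, (hf x hx).deriv]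

lemma isImage_of_mem_closedGraph {β : ℝ} (hβ : 0 ≤ β) {p : CZeroInfty × CZeroInfty}
    (hp : p ∈ closedGraph β) : IsImage 1 β p.1 p.2 := by
  obtain ⟨w, h1, h2, -, h3⟩ := closedGraph_structure hβ hp
  have hd1 : ∀ x, 0 < x → deriv (onReal p.1) x = w x := fun x hx => (h1 x hx).deriv
  have hd2 : ∀ x, 0 < x → deriv (deriv (onReal p.1)) x = (onReal p.2 x - β * w x) / x := by
    intro x hx
    rw [← (h2 x hx).deriv]
    refine Filter.EventuallyEq.deriv_eq ?_
    filter_upwards [lt_mem_nhds hx] with y hy using hd1 y hy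
  have hxd : ∀ x : ℝ, 0 < x → (x : ℂ) * deriv (deriv (onReal p.1)) x = onReal p.2 x - β * w x := by
    intro x hx
    have hxc : (x : ℂ) ≠ 0 := by exact_mod_cast hx.ne'
    rw [hd2 x hx]; field_simp
  have hE : ∀ x, 0 < x → onReal p.2 x = diffExpr 1 β (onReal p.1) x := by
    intro x hx
    rw [diffExpr, Complex.ofReal_one, one_mul, hxd x hx, hd1 x hx]; ring
  have hwc : ContinuousOn w (Ioi 0) := fun x hx => (h2 x hx).continuousAt.continuousWithinAt
  have htop : p.2 ⊤ = 0 := closedGraph_le (S := {p | p.2 ⊤ = 0})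
    (isClosed_eq ((continuous_eval_const (F := CZeroInfty) _).comp continuous_snd)
      continuous_const) (fun q hq => by
        obtain ⟨U, U₁, U₂, hU⟩ := exists_isSmoothPair q hq
        exact hU.5) p hp
  refine ⟨⟨?_, ?_, ?_, ?_⟩, hE⟩
  · rw [show (2 : WithTop ℕ∞) = 1 + 1 from one_add_one_eq_two.symm,
      contDiffOn_succ_iff_deriv_of_isOpen isOpen_Ioi]
    refine ⟨fun x hx => (h1 x hx).differentiableAt.differentiableWithinAt,
      fun h => absurd h (by decide), ?_⟩
    refine (contDiffOn_one_of_hasDerivAt isOpen_Ioi h2 ?_).congr hd1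
    refine ContinuousOn.div ?_ Complex.continuous_ofReal.continuousOn fun x hx => ?_
    · exact (continuous_onReal _).continuousOn.sub (continuousOn_const.mul hwc)
    · exact_mod_cast (ne_of_gt hx)
  · have := tendsto_onReal_atTop p.2
    rw [htop] at this
    refine this.congr' ?_
    filter_upwards [eventually_gt_atTop 0] with x hx using hE x hx
  · rintro rfl
    have h0 : onReal p.2 0 = 0 := closedGraph_le (S := {p | onReal p.2 0 = 0})
      (isClosed_eq ((continuous_onReal_left 0).comp continuous_snd) continuous_const)
      (fun q hq => by
        obtain ⟨U, U₁, U₂, hU⟩ := exists_isSmoothPair q hq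
        simpa using hU.4 0 le_rfl) p hp
    have := (continuous_onReal p.2).tendsto 0
    rw [h0] at this
    refine (this.mono_left nhdsWithin_le_nhds).congr' ?_
    filter_upwards [self_mem_nhdsWithin] with x hx using hE x hx
  · intro hb
    obtain ⟨h4, h5⟩ := h3 (lt_of_le_of_ne hβ hb.symm)
    have h4' : Tendsto w (𝓝[>] 0) (𝓝 (w 0)) := h4.tendsto.mono_left
      (nhdsWithin_mono _ Ioi_subset_Ici_self)
    have hd0 : HasDerivWithinAt (onReal p.1) (w 0) (Ici 0) 0 := by
      refine hasDerivWithinAt_Ici_of_tendsto_deriv (s := Ioi 0)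
        (fun x hx => (h1 x hx).differentiableAt.differentiableWithinAt)
        (continuous_onReal _).continuousWithinAt self_mem_nhdsWithin (h4'.congr' ?_)
      filter_upwards [self_mem_nhdsWithin] with x hx using (hd1 x hx).symm
    have hdw : ∀ x ∈ Ici (0 : ℝ), HasDerivWithinAt (onReal p.1) (w x) (Ici 0) x := by
      intro x hx
      rcases (mem_Ici.1 hx).eq_or_lt with h | h
      · rw [← h]; exact hd0
      · exact (h1 x h).hasDerivWithinAt
    refine ⟨?_, ?_⟩
    · rw [contDiffOn_one_iff_derivWithin (uniqueDiffOn_Ici 0)]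
      refine ⟨fun x hx => (hdw x hx).differentiableWithinAt, ?_⟩
      have hwc' : ContinuousOn w (Ici 0) := by
        intro x hx
        rcases (mem_Ici.1 hx).eq_or_lt with h | h
        · rw [← h]; exact h4
        · exact (h2 x h).continuousAt.continuousWithinAt
      exact hwc'.congr fun x hx => (hdw x hx).derivWithin (uniqueDiffOn_Ici 0 x hx)
    · have h6 : Tendsto (fun x => onReal p.2 x - β * w x) (𝓝[>] 0)
          (𝓝 (onReal p.2 0 - β * w 0)) :=
        (((continuous_onReal p.2).tendsto 0).mono_left nhdsWithin_le_nhds).sub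
          (h4'.const_mul _)
      rw [h5, sub_self] at h6
      refine h6.congr' ?_
      filter_upwards [self_mem_nhdsWithin] with x hx using (hxd x hx).symm

/-! ### The prescribed domain and the maximum principle -/

lemma IsImage.contDiffAt {γ b : ℝ} {u v : CZeroInfty} (h : IsImage γ b u v) {x : ℝ} (hx : 0 < x) :
    ContDiffAt ℝ 2 (onReal u) x :=
  h.1.1.contDiffAt (Ioi_mem_nhds hx)

lemma IsImage.hasDerivAt {γ b : ℝ} {u v : CZeroInfty} (h : IsImage γ b u v) {x : ℝ} (hx : 0 < x) :
    HasDerivAt (onReal u) (deriv (onReal u) x) x :=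
  ((h.contDiffAt hx).differentiableAt (by norm_num)).hasDerivAt

lemma IsImage.hasDerivAt_deriv {γ b : ℝ} {u v : CZeroInfty} (h : IsImage γ b u v) {x : ℝ}
    (hx : 0 < x) : HasDerivAt (deriv (onReal u)) (deriv (deriv (onReal u)) x) x := by
  have h1 := h.1.1
  rw [show (2 : WithTop ℕ∞) = 1 + 1 from one_add_one_eq_two.symm,
    contDiffOn_succ_iff_deriv_of_isOpen isOpen_Ioi] at h1
  exact ((h1.2.2.differentiableOn one_ne_zero).differentiableAt (Ioi_mem_nhds hx)).hasDerivAt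

lemma IsImage.sub {γ b : ℝ} {u v u' v' : CZeroInfty} (h : IsImage γ b u v)
    (h' : IsImage γ b u' v') : IsImage γ b (u - u') (v - v') := by
  have he : onReal (u - u') = onReal u - onReal u' := rfl
  have hd1 : ∀ x, 0 < x →
      deriv (onReal (u - u')) x = deriv (onReal u) x - deriv (onReal u') x := fun x hx => by
    rw [he]; exact ((h.hasDerivAt hx).sub (h'.hasDerivAt hx)).deriv
  have hd2 : ∀ x, 0 < x → deriv (deriv (onReal (u - u'))) x
      = deriv (deriv (onReal u)) x - deriv (deriv (onReal u')) x := fun x hx => by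
    rw [← ((h.hasDerivAt_deriv hx).sub (h'.hasDerivAt_deriv hx)).deriv]
    refine Filter.EventuallyEq.deriv_eq ?_
    filter_upwards [lt_mem_nhds hx] with y hy using hd1 y hy
  have hE : ∀ x, 0 < x → diffExpr γ b (onReal (u - u')) x
      = diffExpr γ b (onReal u) x - diffExpr γ b (onReal u') x := fun x hx => by
    rw [diffExpr, hd1 x hx, hd2 x hx, diffExpr, diffExpr]; ring
  refine ⟨⟨h.1.1.sub h'.1.1, ?_, fun hb => ?_, fun hb => ⟨?_, ?_⟩⟩, fun x hx => ?_⟩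
  · have := h.1.2.1.sub h'.1.2.1
    rw [sub_zero] at this
    refine this.congr' ?_
    filter_upwards [eventually_gt_atTop 0] with x hx using (hE x hx).symm
  · have := (h.1.2.2.1 hb).sub (h'.1.2.2.1 hb)
    rw [sub_zero] at this
    refine this.congr' ?_
    filter_upwards [self_mem_nhdsWithin] with x hx using (hE x hx).symm
  · exact (h.1.2.2.2 hb).1.sub (h'.1.2.2.2 hb).1
  · have := (h.1.2.2.2 hb).2.sub (h'.1.2.2.2 hb).2
    rw [sub_zero] at this
    refine this.congr' ?_
    filter_upwards [self_mem_nhdsWithin] with x hx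
    rw [hd2 x hx]; ring
  · rw [hE x hx, ← h.2 x hx, ← h'.2 x hx]; rfl

/-- Maximum principle: `A u = u` has only the trivial solution. -/
lemma eq_zero_of_isImage_self {β : ℝ} (hβ : 0 ≤ β) {u : CZeroInfty} (h : IsImage 1 β u u) :
    u = 0 := by
  by_contra hu
  obtain ⟨p, -, hp⟩ := isCompact_univ.exists_isMaxOn (univ_nonempty (α := ℝ≥0∞))
    (u.continuous.norm.continuousOn)
  have hmax : ∀ q, ‖u q‖ ≤ ‖u p‖ := fun q => hp (mem_univ q)
  have hpos : 0 < ‖u p‖ := by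
    by_contra hcon
    refine hu (ContinuousMap.ext fun q => ?_)
    exact norm_le_zero_iff.1 ((hmax q).trans (not_lt.1 hcon))
  have heq : ∀ x : ℝ, 0 < x → onReal u x
      = (x : ℂ) * deriv (deriv (onReal u)) x + β * deriv (onReal u) x := fun x hx => by
    have := h.2 x hx
    rwa [diffExpr, Complex.ofReal_one, one_mul] at this
  -- Rotating the phase makes the value at a maximum point of `|u|` real and positive; the real part
  -- `g` then solves the same equation and attains its maximum there.
  set α : ℂ := (starRingEnd ℂ) (u p) / ‖u p‖ with hα
  have hpc : ((‖u p‖ : ℝ) : ℂ) ≠ 0 := by exact_mod_cast hpos.ne'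
  have hαp : α * u p = ‖u p‖ := by
    rw [hα, div_mul_eq_mul_div, mul_comm, Complex.mul_conj, Complex.normSq_eq_norm_sq,
      div_eq_iff hpc]
    push_cast; ring
  have hαn : ‖α‖ = 1 := by
    rw [hα, norm_div, RCLike.norm_conj, Complex.norm_real, norm_norm, div_self hpos.ne']
  set g : ℝ → ℝ := fun x => (α * onReal u x).re with hg
  have hgle : ∀ x, g x ≤ ‖u p‖ := fun x => by
    refine (Complex.re_le_norm _).trans ?_
    rw [norm_mul, hαn, one_mul]
    exact hmax _
  have hgc : Continuous g :=
    Complex.continuous_re.comp (continuous_const.mul (continuous_onReal u))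
  have hg1 : ∀ x, 0 < x → HasDerivAt g (α * deriv (onReal u) x).re x := fun x hx =>
    Complex.reCLM.hasFDerivAt.comp_hasDerivAt x ((h.hasDerivAt hx).const_mul α)
  have hg2 : ∀ x, 0 < x → deriv (deriv g) x = (α * deriv (deriv (onReal u)) x).re := fun x hx => by
    have h1 : HasDerivAt (fun x => (α * deriv (onReal u) x).re) _ x :=
      Complex.reCLM.hasFDerivAt.comp_hasDerivAt x ((h.hasDerivAt_deriv hx).const_mul α)
    refine Eq.trans ?_ h1.deriv
    refine Filter.EventuallyEq.deriv_eq ?_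
    filter_upwards [lt_mem_nhds hx] with y hy using (hg1 y hy).deriv
  have hgeq : ∀ x, 0 < x → g x = x * deriv (deriv g) x + β * deriv g x := fun x hx => by
    rw [hg2 x hx, (hg1 x hx).deriv, ← Complex.re_ofReal_mul, ← Complex.re_ofReal_mul,
      ← Complex.add_re]
    simp only [hg]
    rw [heq x hx]
    congr 1; ring
  by_cases hpt : p = ⊤
  · have h0 : u ⊤ = 0 := tendsto_nhds_unique (tendsto_onReal_atTop u) (h.1.2.1.congr' (by
      filter_upwards [eventually_gt_atTop 0] with x hx using (h.2 x hx).symm))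
    rw [hpt, h0, norm_zero] at hpos
    exact lt_irrefl _ hpos
  set x₀ := p.toReal with hx₀
  have hgx₀ : g x₀ = ‖u p‖ := by
    simp only [hg]
    rw [hx₀, onReal_toReal u hpt, hαp, Complex.ofReal_re]
  rcases (ENNReal.toReal_nonneg (a := p)).eq_or_lt with hx0 | hx0
  · rw [← hx₀] at hx0
    rw [← hx0] at hgx₀
    rcases hβ.eq_or_lt with hb | hb
    · have h0 : onReal u 0 = 0 := tendsto_nhds_unique
        (((continuous_onReal u).tendsto 0).mono_left (nhdsWithin_le_nhds (s := Ioi 0)))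
        ((h.1.2.2.1 hb.symm).congr' (by
          filter_upwards [self_mem_nhdsWithin] with x hx using (h.2 x hx).symm))
      simp only [hg, h0, mul_zero, Complex.zero_re] at hgx₀
      exact hpos.ne hgx₀
    -- Since `xg'' → 0`, the equation forces `βg' → g(0) > 0`, so `g` increases to the right of its
    -- supposed maximum.
    · have h1 : Tendsto (fun x => β * deriv g x) (𝓝[>] 0) (𝓝 (g 0)) := by
        have h2 : Tendsto (fun x : ℝ => (α * ((x : ℂ) * deriv (deriv (onReal u)) x)).re)
            (𝓝[>] 0) (𝓝 (α * 0).re) :=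
          (Complex.continuous_re.tendsto _).comp ((h.1.2.2.2 hb.ne').2.const_mul α)
        have h3 := ((hgc.tendsto 0).mono_left (nhdsWithin_le_nhds (s := Ioi 0))).sub h2
        rw [mul_zero, Complex.zero_re, sub_zero] at h3
        refine h3.congr' ?_
        filter_upwards [self_mem_nhdsWithin] with x hx
        rw [hgeq x hx, hg2 x hx, ← Complex.re_ofReal_mul]
        rw [show α * ((x : ℂ) * deriv (deriv (onReal u)) x)
          = (x : ℂ) * (α * deriv (deriv (onReal u)) x) by ring]
        ring
      have h2 : ∀ᶠ x in 𝓝[>] (0 : ℝ), 0 < deriv g x := by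
        filter_upwards [h1.eventually (lt_mem_nhds (hgx₀ ▸ hpos))] with x hx
        exact (mul_pos_iff_of_pos_left hb).1 hx
      obtain ⟨δ, hδ, hδs⟩ := mem_nhdsGT_iff_exists_Ioc_subset.1 h2
      have hδ0 : (0 : ℝ) < δ := hδ
      have hmono : StrictMonoOn g (Icc 0 δ) := by
        refine strictMonoOn_of_deriv_pos (convex_Icc 0 δ) hgc.continuousOn fun x hx => ?_
        rw [interior_Icc] at hx
        exact hδs ⟨hx.1, hx.2.le⟩
      have := hmono (left_mem_Icc.2 hδ0.le) (right_mem_Icc.2 hδ0.le) hδ0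
      rw [hgx₀] at this
      exact absurd (hgle δ) (not_le.2 this)
  · have hlmax : IsLocalMax g x₀ := Eventually.of_forall fun x => by
      rw [hgx₀]; exact hgle x
    have hd0 : deriv g x₀ = 0 := hlmax.deriv_eq_zero
    have hdd : 0 < deriv (deriv g) x₀ := by
      have := hgeq x₀ hx0
      rw [hgx₀, hd0, mul_zero, add_zero] at this
      rw [this] at hpos
      exact (mul_pos_iff_of_pos_left hx0).1 hpos
    -- At an interior maximum `x g'' = g > 0`, so the point is also a local minimum. Then `g` is
    -- locally constant, contradicting `g'' > 0`.
    have hlmin := isLocalMin_of_deriv_deriv_pos hdd hd0 hgc.continuousAt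
    have hconst : g =ᶠ[𝓝 x₀] fun _ => g x₀ := by
      filter_upwards [hlmax, hlmin] with x h1 h2 using le_antisymm h1 h2
    have hdz : deriv g =ᶠ[𝓝 x₀] fun _ => 0 := by
      have := hconst.deriv
      simpa using this
    rw [hdz.deriv_eq, deriv_const] at hdd
    exact lt_irrefl _ hdd

/-! ### The kernels as Poisson–Gamma mixtures -/

/-- The density of the Gamma distribution of shape `a` and scale `s`. -/
noncomputable def gammaDensity (a s y : ℝ) : ℝ :=
  (1 / s) ^ a / Real.Gamma a * y ^ (a - 1) * Real.exp (-(1 / s * y))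

lemma gammaDensity_nonneg {a s y : ℝ} (ha : 0 < a) (hs : 0 < s) (hy : 0 < y) :
    0 ≤ gammaDensity a s y := by
  have := Real.Gamma_pos_of_pos ha
  unfold gammaDensity; positivity

lemma integrableOn_gammaDensity {a s : ℝ} (ha : 0 < a) (hs : 0 < s) :
    IntegrableOn (gammaDensity a s) (Ioi 0) := by
  have h := integrableOn_rpow_mul_exp_neg_mul_rpow (s := a - 1) (p := 1) (b := 1 / s)
    (by linarith) one_pos (by positivity)
  refine IntegrableOn.congr_fun (h.const_mul ((1 / s) ^ a / Real.Gamma a)) (fun y _ => ?_)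
    measurableSet_Ioi
  simp only [gammaDensity, Real.rpow_one]
  ring_nf

lemma integral_gammaDensity {a s : ℝ} (ha : 0 < a) (hs : 0 < s) :
    ∫ y in Ioi (0 : ℝ), gammaDensity a s y = 1 := by
  have hG := (Real.Gamma_pos_of_pos ha).ne'
  have hr : (1 / s) ^ a ≠ 0 := (Real.rpow_pos_of_pos (by positivity) a).ne'
  simp only [gammaDensity, mul_assoc]
  rw [integral_const_mul, Real.integral_rpow_mul_exp_neg_mul_Ioi ha (by positivity),
    Real.div_rpow zero_le_one (x := 1) (y := 1 / s) (by positivity), Real.one_rpow]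
  field_simp

lemma integral_tsum_gammaDensity {w a : ℕ → ℝ} (hw : ∀ m, 0 ≤ w m) (hws : Summable w)
    (ha : ∀ m, 0 < a m) {s : ℝ} (hs : 0 < s) (f : CZeroInfty) :
    ∫ y in Ioi (0 : ℝ), ((∑' m, w m * gammaDensity (a m) s y : ℝ) : ℂ) * onReal f y
      = ∑' m, w m • ∫ y in Ioi (0 : ℝ), gammaDensity (a m) s y • onReal f y := by
  have hbase : ∀ m, Integrable (fun y => gammaDensity (a m) s y • onReal f y)
      (volume.restrict (Ioi 0)) := fun m => by
    refine (((integrableOn_gammaDensity (ha m) hs).norm).mul_const ‖f‖).mono'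
      ((integrableOn_gammaDensity (ha m) hs).aestronglyMeasurable.smul
        (continuous_onReal f).aestronglyMeasurable) (ae_of_all _ fun y => ?_)
    rw [norm_smul]
    exact mul_le_mul_of_nonneg_left (norm_onReal_le f y) (norm_nonneg _)
  have hint : ∀ m, Integrable (fun y => w m • (gammaDensity (a m) s y • onReal f y))
      (volume.restrict (Ioi 0)) := fun m => (hbase m).smul (w m)
  have hsum : Summable fun m => ∫ y in Ioi (0 : ℝ),
      ‖w m • (gammaDensity (a m) s y • onReal f y)‖ := by
    refine Summable.of_nonneg_of_le (fun m => integral_nonneg fun y => norm_nonneg _) (fun m => ?_)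
      (hws.mul_right ‖f‖)
    calc ∫ y in Ioi (0 : ℝ), ‖w m • (gammaDensity (a m) s y • onReal f y)‖
        ≤ ∫ y in Ioi (0 : ℝ), w m * ‖f‖ * gammaDensity (a m) s y := by
          refine setIntegral_mono_on (hint m).norm
            ((integrableOn_gammaDensity (ha m) hs).const_mul _) measurableSet_Ioi fun y hy => ?_
          have h1 := gammaDensity_nonneg (ha m) hs hy
          rw [norm_smul, norm_smul, Real.norm_of_nonneg (hw m), Real.norm_of_nonneg h1]
          have := mul_le_mul_of_nonneg_left (norm_onReal_le f y) (mul_nonneg (hw m) h1)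
          linarith
      _ = w m * ‖f‖ := by rw [integral_const_mul, integral_gammaDensity (ha m) hs, mul_one]
  have h := integral_tsum_of_summable_integral_norm hint hsum
  simp only [integral_smul] at h
  rw [h]
  refine integral_congr_ae (ae_of_all _ fun y => ?_)
  simp only [Complex.ofReal_tsum, ← tsum_mul_right]
  refine tsum_congr fun m => ?_
  rw [Complex.real_smul, Complex.real_smul]; push_cast; ring

lemma coeff_eq_integral {β t : ℝ} {m : ℕ} (hm : 0 < (m : ℝ) + β) (ht : 0 < t) (f : CZeroInfty) :
    coeff β t f m = ∫ y in Ioi (0 : ℝ), gammaDensity (m + β) t y • onReal f y :=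
  integral_gammaLaw hm ht _

lemma kernelPos_eq {γ b x y t : ℝ} (hγ : 0 < γ) (ht : 0 < t) (hy : 0 < y) :
    kernelPos γ b x y t
      = ∑' m : ℕ, poissonWeight (x / (γ * t)) m * gammaDensity (m + b / γ) (γ * t) y := by
  have hs : 0 < γ * t := by positivity
  rw [kernelPos, ← tsum_mul_left]
  refine tsum_congr fun m => ?_
  set β := b / γ
  have e1 : Real.exp (-((x + y) / (γ * t)))
      = Real.exp (-(x / (γ * t))) * Real.exp (-(1 / (γ * t) * y)) := by
    rw [← Real.exp_add]; congr 1; ring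
  have e2 : (1 / (γ * t)) ^ ((m : ℝ) + β) = (γ * t) ^ (-β) * ((γ * t) ^ m)⁻¹ := by
    rw [one_div, Real.inv_rpow hs.le, ← Real.rpow_neg hs.le, neg_add, add_comm,
      Real.rpow_add hs, Real.rpow_neg hs.le (m : ℝ), Real.rpow_natCast]
  have e3 : y ^ ((m : ℝ) + β - 1) = y ^ (β - 1) * y ^ m := by
    rw [← Real.rpow_natCast, ← Real.rpow_add hy]; congr 1; ring
  rw [e1, poissonWeight, gammaDensity, e2, e3, div_pow, mul_pow, pow_mul', pow_mul' t 2 m]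
  simp only [div_eq_mul_inv, mul_inv, one_mul]
  ring

/-- The Poisson index is shifted by one because the term of index `0` has shape `0` and is the point
mass at the origin. -/
lemma kernelZero_eq {γ x y t : ℝ} (hγ : 0 < γ) (ht : 0 < t) :
    kernelZero γ x y t = ∑' m : ℕ, poissonWeight (x / (γ * t)) (m + 1)
      * gammaDensity ((m + 1 : ℕ) + 0) (γ * t) y := by
  have hs : 0 < γ * t := by positivity
  rw [kernelZero, ← tsum_mul_left]
  refine tsum_congr fun m => ?_
  have e1 : Real.exp (-((x + y) / (γ * t)))
      = Real.exp (-(x / (γ * t))) * Real.exp (-(1 / (γ * t) * y)) := by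
    rw [← Real.exp_add]; congr 1; ring
  have e2 : (1 / (γ * t)) ^ (((m + 1 : ℕ) : ℝ) + 0) = ((γ * t) ^ (m + 1))⁻¹ := by
    rw [add_zero, Real.rpow_natCast, one_div, inv_pow]
  have e3 : y ^ (((m + 1 : ℕ) : ℝ) + 0 - 1) = y ^ m := by
    rw [← Real.rpow_natCast]; congr 1; push_cast; ring
  have e4 : Real.Gamma (((m + 1 : ℕ) : ℝ) + 0) = m.factorial := by
    rw [add_zero]; push_cast; exact Real.Gamma_nat_eq_factorial m
  rw [e1, poissonWeight, gammaDensity, e2, e3, e4, div_pow]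
  simp only [mul_pow, pow_succ, pow_mul']
  field_simp

lemma semigroup_eq_diffSum {γ b t x : ℝ} (hγ : 0 < γ) (hb : 0 ≤ b) (ht : 0 < t) (hx : 0 ≤ x)
    (f : CZeroInfty) : semigroup γ b t f x = diffSum 0 (b / γ) (γ * t) x f := by
  have hs : 0 < γ * t := by positivity
  have hz : 0 ≤ x / (γ * t) := by positivity
  rw [diffSum_apply, Function.iterate_zero, id, poissonSum, semigroup]
  split_ifs with h
  · subst h
    rw [zero_div]
    have h0 := hasSum_poissonSum (norm_coeff_le 0 (γ * t) f) (x / (γ * t))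
    rw [h0.summable.tsum_eq_zero_add]
    congr 1
    · rw [coeff, gammaLaw, if_neg (by simp), integral_dirac]
      simp [poissonWeight]
    · rw [setIntegral_congr_fun measurableSet_Ioi
        (g := fun y => ((∑' m : ℕ, poissonWeight (x / (γ * t)) (m + 1)
          * gammaDensity ((m + 1 : ℕ) + 0) (γ * t) y : ℝ) : ℂ) * onReal f y)
        fun y _ => by simp only [kernelZero_eq hγ ht],
        integral_tsum_gammaDensity (w := fun m => poissonWeight (x / (γ * t)) (m + 1))
          (fun m => poissonWeight_nonneg hz _)
          ((summable_nat_add_iff 1).2 (hasSum_poissonWeight _).summable)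
          (fun m => by positivity) hs f]
      refine tsum_congr fun m => ?_
      rw [coeff_eq_integral (by positivity) hs]
  · have hb0 : 0 < b := lt_of_le_of_ne hb (Ne.symm h)
    have hβ : 0 < b / γ := by positivity
    rw [setIntegral_congr_fun measurableSet_Ioi
        (g := fun y => ((∑' m : ℕ, poissonWeight (x / (γ * t)) m
          * gammaDensity (m + b / γ) (γ * t) y : ℝ) : ℂ) * onReal f y)
        fun y hy => by simp only [kernelPos_eq hγ ht (mem_Ioi.1 hy)],
        integral_tsum_gammaDensity (w := poissonWeight (x / (γ * t)))
          (fun m => poissonWeight_nonneg hz _) (hasSum_poissonWeight _).summable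
          (fun m => by positivity) hs f]
    refine tsum_congr fun m => ?_
    rw [coeff_eq_integral (by positivity) hs]

lemma semigroup_gradient {γ b t : ℝ} (hγ : 0 < γ) (hb : 0 ≤ b) (ht : 0 < t) (f : CZeroInfty) :
    ContDiffOn ℝ 1 (semigroup γ b t f) (Ici 0) ∧ ∀ x : ℝ, 0 ≤ x →
      ‖(√x : ℂ) * derivWithin (semigroup γ b t f) (Ici 0) x‖ ≤ ‖f‖ / √(γ * t) := by
  have heq : ∀ x ∈ Ici (0 : ℝ), semigroup γ b t f x = diffSum 0 (b / γ) (γ * t) x f :=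
    fun x hx => semigroup_eq_diffSum hγ hb ht hx f
  refine ⟨?_, fun x hx => ?_⟩
  · refine ContDiffOn.congr ?_ heq
    exact ((contDiff_one_poissonSum (norm_coeff_le (b / γ) (γ * t) f)).comp
      (contDiff_id.div_const _)).contDiffOn
  · rw [derivWithin_congr heq (heq x hx), (hasDerivAt_diffSum_zero _ _ x f).hasDerivWithinAt.derivWithin
      (uniqueDiffOn_Ici 0 x hx), norm_mul, Complex.norm_real,
      Real.norm_of_nonneg (Real.sqrt_nonneg x)]
    exact sqrt_mul_norm_diffSum_one_le _ (by positivity) hx f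

/-! ### Identification of the generator, scaling and uniformity -/

/-- The closure is contained in the graph of `A`, and `1 - A` is onto already on the closure and
injective on the full domain, so the two graphs coincide. -/
lemma mem_closedGraph_iff {β : ℝ} (hβ : 0 ≤ β) {u v : CZeroInfty} :
    (u, v) ∈ closedGraph β ↔ IsImage 1 β u v := by
  refine ⟨fun h => isImage_of_mem_closedGraph hβ h, fun h => ?_⟩
  have hre : -(‖(1 : ℂ)‖ / (8 * (4 + 16 * (2 + 2 * β)))) < (1 : ℂ).re := by
    have : 0 ≤ ‖(1 : ℂ)‖ / (8 * (4 + 16 * (2 + 2 * β))) := by positivity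
    rw [Complex.one_re]; linarith
  obtain ⟨R, hR, -⟩ := exists_resolvent_closedGraph hβ le_rfl one_ne_zero hre
  have h1 := hR (u - v)
  rw [one_smul] at h1
  have h2 := h.sub (isImage_of_mem_closedGraph hβ h1)
  simp only at h2
  rw [show v - (R (u - v) - (u - v)) = u - R (u - v) by abel] at h2
  have h3 := sub_eq_zero.1 (eq_zero_of_isImage_self hβ h2)
  rw [← h3, sub_sub_cancel] at h1
  exact h1

lemma diffExpr_scale {γ : ℝ} (hγ : 0 < γ) (b : ℝ) (u : ℝ → ℂ) (x : ℝ) :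
    diffExpr γ b u x = γ * diffExpr 1 (b / γ) u x := by
  have : (γ : ℂ) ≠ 0 := by exact_mod_cast hγ.ne'
  simp only [diffExpr]
  push_cast
  field_simp

lemma isImage_scale {γ : ℝ} (hγ : 0 < γ) {b : ℝ} {u v : CZeroInfty} :
    IsImage γ b u v ↔ IsImage 1 (b / γ) u ((γ : ℂ)⁻¹ • v) := by
  have hγc : (γ : ℂ) ≠ 0 := by exact_mod_cast hγ.ne'
  have hfun : diffExpr γ b (onReal u) = fun x => (γ : ℂ) * diffExpr 1 (b / γ) (onReal u) x :=
    funext (diffExpr_scale hγ b (onReal u))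
  have ht : ∀ l : Filter ℝ, Tendsto (diffExpr γ b (onReal u)) l (𝓝 0) ↔
      Tendsto (diffExpr 1 (b / γ) (onReal u)) l (𝓝 0) := by
    intro l
    rw [hfun]
    refine ⟨fun h => ?_, fun h => by simpa using h.const_mul (γ : ℂ)⟩
    simpa [← mul_assoc, inv_mul_cancel₀ hγc] using h.const_mul (γ : ℂ)⁻¹
  have hb : b / γ = 0 ↔ b = 0 := by simp [hγ.ne']
  simp only [IsImage, InDomain, ht, hb, ne_eq]
  refine and_congr_right fun _ => forall₂_congr fun x _ => ?_
  have : onReal ((γ : ℂ)⁻¹ • v) x = (γ : ℂ)⁻¹ * onReal v x := rfl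
  rw [this, diffExpr_scale hγ, inv_mul_eq_iff_eq_mul₀ hγc]

lemma re_ge_of_abs_arg_le {l : ℂ} {θ : ℝ} (hθ : 0 ≤ θ) (hθ' : θ ≤ Real.pi / 2)
    (h : |l.arg| ≤ Real.pi / 2 + θ) : -(θ * ‖l‖) ≤ l.re := by
  have h1 : -θ ≤ Real.cos l.arg := by
    rw [← Real.cos_abs]
    refine le_trans ?_ (Real.cos_le_cos_of_nonneg_of_le_pi (abs_nonneg _) (by linarith) h)
    rw [add_comm, Real.cos_add_pi_div_two]
    exact neg_le_neg (Real.sin_le hθ)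
  rw [← Complex.norm_mul_cos_arg l]
  nlinarith [norm_nonneg l]

/-- The resolvent is `γ⁻¹ R(l/γ, A^{1,b/γ})`. Uniformity follows from `b/γ ≤ B/γ₀`, and
`γ⁻¹/√(|l|/γ) = 1/√(γ|l|)` explains the factor `1/√γ₀`. -/
lemma exists_isResolvent_of_re {B γ₀ : ℝ} (hB : 0 < B) (hγ₀ : 0 < γ₀) {K : ℝ}
    (hK : K = 4 + 16 * (2 + 2 * (B / γ₀))) {b γ : ℝ} (hb : b ∈ Icc 0 B) (hγ : γ₀ ≤ γ) {l : ℂ}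
    (hl : l ≠ 0) (hre : -(‖l‖ / (8 * K)) < l.re) :
    ∃ R : CZeroInfty →L[ℂ] CZeroInfty, IsResolvent γ b l R ∧ ∀ f : CZeroInfty,
      ContDiffOn ℝ 1 (onReal (R f)) (Ioi 0) ∧
      Tendsto (fun x : ℝ => (√x : ℂ) * deriv (onReal (R f)) x) (𝓝[>] 0) (𝓝 0) ∧
      ∀ x : ℝ, 0 < x → ‖(√x : ℂ) * deriv (onReal (R f)) x‖
        ≤ (3 * K + 2) / √γ₀ * (‖f‖ / √‖l‖) := by
  have hγ0 : 0 < γ := hγ₀.trans_le hγ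
  have hγc : (γ : ℂ) ≠ 0 := by exact_mod_cast hγ0.ne'
  have hβ : 0 ≤ b / γ := div_nonneg hb.1 hγ0.le
  have hM : 2 + 2 * (b / γ) ≤ 2 + 2 * (B / γ₀) := by
    have := div_le_div₀ hB.le hb.2 hγ₀ hγ
    linarith
  set M := 2 + 2 * (B / γ₀) with hMdef
  have hM0 : 0 < M := by positivity
  have hK0 : 0 < K := by rw [hK]; positivity
  set l' : ℂ := (γ : ℂ)⁻¹ * l with hl'
  have hl'0 : l' ≠ 0 := mul_ne_zero (inv_ne_zero hγc) hl
  have hnl : ‖l'‖ = ‖l‖ / γ := by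
    rw [hl', norm_mul, norm_inv, Complex.norm_real, Real.norm_of_nonneg hγ0.le]; ring
  have hnl0 : 0 < ‖l'‖ := norm_pos_iff.2 hl'0
  have hre' : -(‖l'‖ / (8 * K)) < l'.re := by
    have h1 : l'.re = l.re / γ := by
      rw [hl', ← Complex.ofReal_inv, Complex.re_ofReal_mul]; ring
    rw [hnl, h1, lt_div_iff₀ hγ0]
    refine lt_of_eq_of_lt ?_ hre
    field_simp
  rw [hK] at hre'
  obtain ⟨R, hR1, hR2⟩ := exists_resolvent_closedGraph hβ hM hl'0 hre'
  have hmem : ∀ f, ((γ : ℂ)⁻¹ • R f, (γ : ℂ)⁻¹ • (l • (γ : ℂ)⁻¹ • R f - f)) ∈ closedGraph (b / γ) := by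
    intro f
    have h1 := (closedGraph (b / γ)).smul_mem (γ : ℂ)⁻¹ (hR1 f)
    rw [Prod.smul_mk, hl'] at h1
    rwa [smul_comm l, smul_smul]
  have hres : IsResolvent γ b l ((γ : ℂ)⁻¹ • R) := by
    refine ⟨fun f => ⟨l • (γ : ℂ)⁻¹ • R f - f, ?_, ?_⟩, fun u v huv => ?_⟩
    · exact (isImage_scale hγ0).2 ((mem_closedGraph_iff hβ).1 (hmem f))
    · rw [smul_apply, sub_sub_cancel]
    · have h1 := hR2 _ ((mem_closedGraph_iff hβ).2 ((isImage_scale hγ0).1 huv))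
      simp only at h1
      rw [smul_apply, ← map_smul, smul_sub, smul_smul]
      exact h1
  refine ⟨(γ : ℂ)⁻¹ • R, hres, fun f => ?_⟩
  obtain ⟨v, hv, -⟩ := hres.1 f
  obtain ⟨w, hw1, -, hw2, -⟩ := closedGraph_structure hβ (hR1 f)
  have hd : ∀ x, 0 < x → deriv (onReal (((γ : ℂ)⁻¹ • R) f)) x = (γ : ℂ)⁻¹ * w x := fun x hx =>
    ((hw1 x hx).const_mul (γ : ℂ)⁻¹).deriv
  refine ⟨hv.1.1.of_le one_le_two, ?_, fun x hx => ?_⟩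
  · have h1 := hw2.const_mul (γ : ℂ)⁻¹
    rw [mul_zero] at h1
    refine h1.congr' ?_
    filter_upwards [self_mem_nhdsWithin] with x hx
    rw [hd x hx]; ring
  · have hs : -(‖l'‖ / (8 * M)) ≤ l'.re := by
      refine le_trans ?_ hre'.le
      rw [neg_le_neg_iff]
      gcongr
      linarith
    have h1 := resolvent_estimate hβ hM hl'0 hs _ (hR1 f)
    have h2 : l' • R f - (l' • R f - f) = f := by abel
    simp only [h2] at h1
    rw [← hK] at h1
    have h3 : ‖l' • R f - f‖ ≤ (K + 1) * ‖f‖ := by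
      refine (norm_sub_le _ _).trans ?_
      rw [norm_smul]; linarith
    -- The choice `t = 1/|l'|` balances the two terms: they contribute `K` and `2(K + 1)`, hence `3K
    -- + 2`.
    have h4 := sqrt_mul_norm_deriv_le hβ (inv_pos.2 hnl0) (hR1 f) hx (hw1 x hx)
    simp only at h4
    have hsl : 0 < √‖l'‖ := Real.sqrt_pos.2 hnl0
    have hll : √‖l'‖ * √‖l'‖ = ‖l'‖ := Real.mul_self_sqrt hnl0.le
    rw [Real.sqrt_inv, div_inv_eq_mul] at h4
    have h5 : √x * ‖w x‖ ≤ (3 * K + 2) * (‖f‖ / √‖l'‖) := by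
      rw [mul_div_assoc', le_div_iff₀ hsl]
      calc √x * ‖w x‖ * √‖l'‖
          ≤ (‖R f‖ * √‖l'‖ + 2 * (√‖l'‖)⁻¹ * ‖l' • R f - f‖) * √‖l'‖ := by gcongr
        _ = ‖l'‖ * ‖R f‖ + 2 * ‖l' • R f - f‖ := by
            have h6 : (√‖l'‖)⁻¹ * √‖l'‖ = 1 := inv_mul_cancel₀ hsl.ne'
            linear_combination ‖R f‖ * hll + 2 * ‖l' • R f - f‖ * h6
        _ ≤ (3 * K + 2) * ‖f‖ := by linarith
    have hsγ0 : 0 < √γ₀ := Real.sqrt_pos.2 hγ₀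
    have hsγ : √γ₀ ≤ √γ := Real.sqrt_le_sqrt hγ
    have hsγp : 0 < √γ := hsγ0.trans_le hsγ
    have hγγ : √γ * √γ = γ := Real.mul_self_sqrt hγ0.le
    have hsl0 : 0 < √‖l‖ := Real.sqrt_pos.2 (norm_pos_iff.2 hl)
    rw [hd x hx, norm_mul, norm_mul, norm_inv, Complex.norm_real, Complex.norm_real,
      Real.norm_of_nonneg hγ0.le, Real.norm_of_nonneg (Real.sqrt_nonneg x)]
    calc √x * (γ⁻¹ * ‖w x‖) = γ⁻¹ * (√x * ‖w x‖) := by ring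
      _ ≤ γ⁻¹ * ((3 * K + 2) * (‖f‖ / √‖l'‖)) := by gcongr
      _ = (3 * K + 2) / √γ * (‖f‖ / √‖l‖) := by
          rw [hnl, Real.sqrt_div (norm_nonneg l)]
          nth_rw 1 [← hγγ]
          field_simp
      _ ≤ (3 * K + 2) / √γ₀ * (‖f‖ / √‖l‖) := by gcongr

end DegenerateDiffusion

open DegenerateDiffusion in
theorem proposition5p1 (B γ₀ : ℝ) (hB : 0 < B) (hγ₀ : 0 < γ₀) :
    (∀ b ∈ Icc 0 B, ∀ γ ≥ γ₀, ∀ (f : CZeroInfty) (t : ℝ), 0 < t →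
      ContDiffOn ℝ 1 (semigroup γ b t f) (Ici 0) ∧
      ∀ x : ℝ, 0 ≤ x →
        ‖(√x : ℂ) * derivWithin (semigroup γ b t f) (Ici 0) x‖ ≤
          2 * √2 / √(γ₀ * t) * ‖f‖) ∧
    ∃ θ₁ ∈ Ioc 0 (Real.pi / 2), ∀ θ ∈ Ioo 0 θ₁, ∃ d₂ : ℝ, 0 < d₂ ∧
      ∀ b ∈ Icc 0 B, ∀ γ ≥ γ₀, ∀ l : ℂ, l ≠ 0 → |l.arg| ≤ Real.pi / 2 + θ →
        ∃ R : CZeroInfty →L[ℂ] CZeroInfty, IsResolvent γ b l R ∧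
          ∀ f : CZeroInfty,
            ContDiffOn ℝ 1 (onReal (R f)) (Ioi 0) ∧
            Tendsto (fun x : ℝ => (√x : ℂ) * deriv (onReal (R f)) x) (𝓝[>] 0) (𝓝 0) ∧
            ∀ x : ℝ, 0 < x →
              ‖(√x : ℂ) * deriv (onReal (R f)) x‖ ≤ d₂ * (‖f‖ / √‖l‖) := by
  constructor
  · intro b hb γ hγ f t ht
    have hγ0 : 0 < γ := hγ₀.trans_le hγ
    obtain ⟨h1, h2⟩ := semigroup_gradient hγ0 hb.1 ht f
    refine ⟨h1, fun x hx => (h2 x hx).trans ?_⟩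
    have hpos : 0 < √(γ₀ * t) := Real.sqrt_pos.2 (by positivity)
    have h3 : √(γ₀ * t) ≤ √(γ * t) := Real.sqrt_le_sqrt (by gcongr)
    -- The gradient bound already holds with constant `1`.
    have h4 : 1 ≤ 2 * √2 := by
      have : 1 ≤ √2 := Real.one_le_sqrt.2 one_le_two
      linarith
    calc ‖f‖ / √(γ * t) ≤ ‖f‖ / √(γ₀ * t) := by gcongr
      _ = 1 / √(γ₀ * t) * ‖f‖ := by ring
      _ ≤ 2 * √2 / √(γ₀ * t) * ‖f‖ := by gcongr
  · obtain ⟨K, hK⟩ : ∃ K, K = 4 + 16 * (2 + 2 * (B / γ₀)) := ⟨_, rfl⟩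
    have hK4 : 4 ≤ K := by rw [hK]; have : 0 ≤ 16 * (2 + 2 * (B / γ₀)) := by positivity
                           linarith
    have hθ1 : 1 / (8 * K) ≤ Real.pi / 2 := by
      have h1 : 1 / (8 * K) ≤ 1 := by rw [div_le_one (by positivity)]; linarith
      linarith [Real.two_le_pi]
    -- As `cos(π/2 + θ) = -sin θ ≥ -θ`, every angle below `1/(8K)` satisfies the real-part condition
    -- required for invertibility.
    refine ⟨1 / (8 * K), ⟨by positivity, hθ1⟩, fun θ hθ => ⟨(3 * K + 2) / √γ₀, ?_, ?_⟩⟩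
    · have := Real.sqrt_pos.2 hγ₀
      positivity
    · intro b hb γ hγ l hl harg
      refine exists_isResolvent_of_re hB hγ₀ hK hb hγ hl ?_
      refine lt_of_lt_of_le ?_ (re_ge_of_abs_arg_le hθ.1.le (hθ.2.le.trans hθ1) harg)
      have h1 : θ * ‖l‖ < 1 / (8 * K) * ‖l‖ :=
        mul_lt_mul_of_pos_right hθ.2 (norm_pos_iff.2 hl)
      have h2 : 1 / (8 * K) * ‖l‖ = ‖l‖ / (8 * K) := by ring
      rw [← h2]
      exact neg_lt_neg h1
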